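/- Let $C>0$, $G\ge 0$, $M>1$, $1<Y<2$, $b\in\mathbb{R}$, $S_0>0$. Let $X=(X_t)_{t\ge 0}$ be a CGMY process, i.e. a real-valued L\'evy process (a.s. càdlàg paths, $X_0=0$ a.s., stationary and independent increments) such that $X_1$ has L\'evy triplet $(b,0,\nu)$ with $$\nu(dx)=\Big(\frac{Ce^{-G|x|}}{|x|^{1+Y}}\mathbf 1_{x<0}+\frac{Ce^{-Mx}}{x^{1+Y}}\mathbf 1_{x>0}\Big)dx,$$ that is, $\mathbb{E}[e^{iuX_1}]=\exp\big(iub+\int_{\mathbb{R}}(e^{iux}-1-iux\mathbf 1_{\{|x|\le 1\}})\,\nu(dx)\big)$ for all $u\in\mathbb{R}$. Assume that $S_t=S_0e^{X_t}$ is a martingale with respect to its own filtration, and let $c(t,0)=\frac1{S_0}\mathbb{E}[(S_t-S_0)_+]$ be the normalized at-the-money call price. Then $$c(t,0)=d_1t^{1/Y}+o(t^{1/Y})\qquad (t\downarrow 0),$$ where $$d_1=\frac1\pi\,\mathrm{Re}\Big(\int_0^\infty\frac{1-e^{\theta_0(u)}}{u^2}\,du\Big)=\frac1\pi\,\Gamma\Big(1-\frac1Y\Big)\Big(2C\,\Gamma(-Y)\Big|\cos\frac{\pi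 Y}{2}\Big|\Big)^{1/Y},$$ the integral converges absolutely, and, with principal powers, $\theta_0(u)=C\,\Gamma(-Y)\big((-i)^Y+i^Y\big)|u|^Y$. -/

import Mathlib

open MeasureTheory ProbabilityTheory Filter Set Asymptotics
open scoped Topology NNReal ENNReal

/-- Càdlàg paths: right-continuous, with a (finite) left limit at every time. -/
def IsCadlagPath (x : ℝ≥0 → ℝ) : Prop :=
  ∀ t : ℝ≥0, ContinuousWithinAt x (Ici t) t ∧ ∃ l : ℝ, Tendsto x (𝓝[<] t) (𝓝 l)

/-- Real-valued Lévy processes `(X_t)_{t ≥ 0}` on a probability space. -/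
structure IsLevyProcess {Ω : Type*} [MeasurableSpace Ω] (X : ℝ≥0 → Ω → ℝ) (P : Measure Ω) :
    Prop where
  measurable : ∀ t, Measurable (X t)
  initial : ∀ᵐ ω ∂P, X 0 ω = 0
  indep_increments : HasIndepIncrements X P
  stationary_increments : ∀ s h : ℝ≥0,
    IdentDistrib (fun ω => X (s + h) ω - X s ω) (fun ω => X h ω - X 0 ω) P P
  cadlag : ∀ᵐ ω ∂P, IsCadlagPath (fun t => X t ω)

/-- Lévy measures on `ℝ`: no atom at the origin and `∫ (1 ∧ x²) ν(dx) < ∞`. -/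
def IsLevyMeasure (ν : Measure ℝ) : Prop :=
  ν {0} = 0 ∧ ∫⁻ x, ENNReal.ofReal (min 1 (x ^ 2)) ∂ν < ∞

/-- The Lévy–Khintchine exponent
`ψ(u) = i u b - σ² u² / 2 + ∫ (e^{iux} - 1 - i u x 1_{|x| ≤ 1}) ν(dx)`. -/
noncomputable def levyKhintchineExponent (b σ : ℝ) (ν : Measure ℝ) (u : ℝ) : ℂ :=
  Complex.I * u * b - (σ : ℂ) ^ 2 * (u : ℂ) ^ 2 / 2
    + ∫ x : ℝ, (Complex.exp (Complex.I * u * x) - 1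
        - Complex.I * u * (if |x| ≤ 1 then (x : ℂ) else 0)) ∂ν

/-- The law `μ` on `ℝ` is infinitely divisible with characteristic triplet `(b, σ, ν)`. -/
structure HasLevyTriplet (μ : Measure ℝ) (b σ : ℝ) (ν : Measure ℝ) : Prop where
  sigma_nonneg : 0 ≤ σ
  isLevyMeasure : IsLevyMeasure ν
  charFun_eq : ∀ u : ℝ, charFun μ u = Complex.exp (levyKhintchineExponent b σ ν u)

/-- Density of the CGMY Lévy measure. -/
noncomputable def cgmyDensity (C G M Y x : ℝ) : ℝ :=
  if x < 0 then C * Real.exp (-G * |x|) / |x| ^ (1 + Y)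
  else if 0 < x then C * Real.exp (-M * x) / x ^ (1 + Y)
  else 0

/-- The CGMY Lévy measure. -/
noncomputable def cgmyLevyMeasure (C G M Y : ℝ) : Measure ℝ :=
  volume.withDensity fun x => ENNReal.ofReal (cgmyDensity C G M Y x)

/-- CGMY processes with parameters `C > 0`, `G, M ≥ 0`, `1 < Y < 2` and drift `b`: Lévy processes
such that `X_1` has characteristic triplet `(b, 0, ν)`, with `ν` the CGMY Lévy measure. -/
structure IsCGMYProcess {Ω : Type*} [MeasurableSpace Ω] (X : ℝ≥0 → Ω → ℝ) (P : Measure Ω)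
    (C G M Y b : ℝ) : Prop where
  C_pos : 0 < C
  G_nonneg : 0 ≤ G
  M_nonneg : 0 ≤ M
  one_lt_Y : 1 < Y
  Y_lt_two : Y < 2
  isLevyProcess : IsLevyProcess X P
  triplet : HasLevyTriplet (P.map (X 1)) b 0 (cgmyLevyMeasure C G M Y)

/-- The asset price `S_t = S₀ e^{X_t}`. -/
noncomputable def expAsset {Ω : Type*} (S₀ : ℝ) (X : ℝ≥0 → Ω → ℝ) (t : ℝ≥0) (ω : Ω) : ℝ :=
  S₀ * Real.exp (X t ω)

/-- `S` is a martingale with respect to its own filtration. -/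
def IsMartingaleOwnFiltration {Ω : Type*} [MeasurableSpace Ω] (S : ℝ≥0 → Ω → ℝ)
    (P : Measure Ω) : Prop :=
  ∃ hS : ∀ t, StronglyMeasurable (S t), Martingale S (Filtration.natural S hS) P

/-- The normalized call price `c(t, k) = E[(S_t - K)₊] / S₀` with `S_t = S₀ e^{X_t}`, at
log-moneyness `k = log (S₀ / K)`, that is, with strike `K = S₀ e^{-k}`. -/
noncomputable def callPrice {Ω : Type*} [MeasurableSpace Ω] (P : Measure Ω) (S₀ : ℝ)
    (X : ℝ≥0 → Ω → ℝ) (t : ℝ≥0) (k : ℝ) : ℝ :=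
  1 / S₀ * ∫ ω, max (expAsset S₀ X t ω - S₀ * Real.exp (-k)) 0 ∂P

/-- `θ₀(u) = C Γ(-Y) ((-i)^Y + i^Y) |u|^Y`, with principal powers. -/
noncomputable def theta0 (C Y u : ℝ) : ℂ :=
  (C : ℂ) * (Real.Gamma (-Y) : ℂ) * ((-Complex.I) ^ (Y : ℂ) + Complex.I ^ (Y : ℂ))
    * ((|u| ^ Y : ℝ) : ℂ)

/-- The integrand `(1 - e^{θ₀(u)}) / u²`. -/
noncomputable def d1Integrand (C Y u : ℝ) : ℂ :=
  (1 - Complex.exp (theta0 C Y u)) / (u : ℂ) ^ 2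

/-- `d₁ = (1/π) Re ∫_0^∞ (1 - e^{θ₀(u)}) / u² du`. -/
noncomputable def d1 (C Y : ℝ) : ℝ :=
  1 / Real.pi * (∫ u in Ioi (0 : ℝ), d1Integrand C Y u).re

/-! Split the payoff as `(e^x - 1)₊ = (e^x - 1)/2 + (1 - e^{-|x|})/2 + callExcess x`. The martingale
property kills the mean of the first term. The second is bounded and, `e^{-|x|}` being the
characteristic function of the Cauchy law, its mean is an integral of `1 - Re charFun` against `1/(1
+ u²)` (`integral_one_sub_exp_neg_abs`). The third vanishes to second order at the origin, and
`callExcess_le` dominates it by functions whose means are controlled by the characteristic function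
on `[-2, 2]`; its mean is therefore `O(t) = o(t^{1/Y})`.

For the Fourier term, `X_t` has characteristic function `e^{tψ}`, and `ψ(u) = -a|u|^Y + O(|u|)` with
`a = 2CΓ(-Y)|cos(πY/2)|`: tempering changes the stable density only by a density with finite first
absolute moment (`exists_lipschitz_levyKhintchineExponent_add_rpow`). Substituting `u = v/ε` with `ε
= t^{1/Y}` extracts a factor `ε`, and dominated convergence (`tendsto_integral_scaled`) leaves `∫₀^∞
(1 - e^{-a v^Y}) / v² dv`. Integration by parts evaluates this integral as `Γ(1 - 1/Y) a^{1/Y}`. -/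

/-! ### The stable integral that gives the leading constant -/

/-- Integrability on `(0, ∞)` from power bounds near `0` and near `∞`. -/
theorem integrableOn_Ioi_zero_of_rpow_bounds {E : Type*} [NormedAddCommGroup E] {f : ℝ → E}
    {A B p q : ℝ} (hf : AEStronglyMeasurable f (volume.restrict (Ioi 0)))
    (hp : -1 < p) (hq : q < -1) (h0 : ∀ x, 0 < x → x ≤ 1 → ‖f x‖ ≤ A * x ^ p)
    (h1 : ∀ x, 1 < x → ‖f x‖ ≤ B * x ^ q) : IntegrableOn f (Ioi 0) := by
  rw [← Ioc_union_Ioi_eq_Ioi (zero_le_one' ℝ)]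
  refine IntegrableOn.union ?_ ?_
  · have hi : IntegrableOn (fun x : ℝ => A * x ^ p) (Ioc 0 1) :=
      ((intervalIntegrable_iff_integrableOn_Ioc_of_le zero_le_one).1
        (intervalIntegral.intervalIntegrable_rpow' hp)).const_mul A
    exact Integrable.mono' hi (hf.mono_measure (Measure.restrict_mono Ioc_subset_Ioi_self le_rfl))
      ((ae_restrict_iff' measurableSet_Ioc).2 (ae_of_all _ fun x hx => h0 x hx.1 hx.2))
  · have hi : IntegrableOn (fun x : ℝ => B * x ^ q) (Ioi 1) :=
      (integrableOn_Ioi_rpow_of_lt hq zero_lt_one).const_mul B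
    exact Integrable.mono' hi
      (hf.mono_measure (Measure.restrict_mono (Ioi_subset_Ioi zero_le_one) le_rfl))
      ((ae_restrict_iff' measurableSet_Ioi).2 (ae_of_all _ fun x hx => h1 x hx))

theorem integrableOn_one_sub_exp_neg_mul_rpow_div_sq {a Y : ℝ} (ha : 0 < a) (hY : 1 < Y) :
    IntegrableOn (fun v : ℝ => (1 - Real.exp (-a * v ^ Y)) / v ^ 2) (Ioi 0) := by
  refine integrableOn_Ioi_zero_of_rpow_bounds (A := a) (B := 1) (p := Y - 2) (q := -2)
    (Measurable.aestronglyMeasurable (by fun_prop)) (by linarith) (by norm_num) (fun x hx _ => ?_) (fun x hx => ?_)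
  · have hxY : 0 < x ^ Y := Real.rpow_pos_of_pos hx _
    have h1 : Real.exp (-a * x ^ Y) ≤ 1 := Real.exp_le_one_iff.2 (by nlinarith)
    have h2 := Real.add_one_le_exp (-a * x ^ Y)
    rw [Real.norm_of_nonneg (div_nonneg (by linarith) (by positivity)),
      Real.rpow_sub hx, Real.rpow_two, ← mul_div_assoc]
    gcongr
    linarith
  · have hx0 : 0 < x := by linarith
    have hxY : 0 < x ^ Y := Real.rpow_pos_of_pos hx0 _
    have h1 : Real.exp (-a * x ^ Y) ≤ 1 := Real.exp_le_one_iff.2 (by nlinarith)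
    rw [Real.norm_of_nonneg (div_nonneg (by linarith) (by positivity)),
      Real.rpow_neg hx0.le, Real.rpow_two, one_mul, ← one_div]
    gcongr
    linarith [Real.exp_pos (-a * x ^ Y)]

/-- Integrating by parts with `-1/v` as primitive of `1/v²` leaves `aY ∫ v^(Y-2) e^{-a v^Y} dv`, a
Gamma integral. The boundary term at `0` is at most `a v^(Y-1)`, which vanishes because `Y > 1`. -/
theorem integral_one_sub_exp_neg_mul_rpow_div_sq {a Y : ℝ} (ha : 0 < a) (hY : 1 < Y) :
    ∫ v in Ioi (0 : ℝ), (1 - Real.exp (-a * v ^ Y)) / v ^ 2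
      = Real.Gamma (1 - 1 / Y) * a ^ (1 / Y) := by
  have hY0 : 0 < Y := by linarith
  have hder1 : ∀ x ∈ Ioi (0 : ℝ), HasDerivAt (fun v : ℝ => 1 - Real.exp (-a * v ^ Y))
      (a * Y * x ^ (Y - 1) * Real.exp (-a * x ^ Y)) x := by
    intro x hx
    have := (((Real.hasDerivAt_rpow_const (p := Y) (Or.inl (ne_of_gt hx))).const_mul (-a)).exp).const_sub 1
    convert! this using 1
    ring
  have hder2 : ∀ x ∈ Ioi (0 : ℝ), HasDerivAt (fun v : ℝ => -v⁻¹) (1 / x ^ 2) x := by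
    intro x hx
    have hx' : x ≠ 0 := ne_of_gt hx
    have := (hasDerivAt_inv hx').neg
    convert! this using 1
    rw [neg_neg, one_div]
  have hint := integrableOn_one_sub_exp_neg_mul_rpow_div_sq ha hY
  have hkey : ∀ x ∈ Ioi (0 : ℝ), a * Y * x ^ (Y - 1) * Real.exp (-a * x ^ Y) * (-x⁻¹)
      = -(a * Y) * (x ^ (Y - 2) * Real.exp (-a * x ^ Y)) := by
    intro x hx
    have : x ^ (Y - 1) = x ^ (Y - 2) * x := by
      rw [← Real.rpow_add_one (ne_of_gt hx)]; ring_nf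
    rw [this]
    have hx' : x ≠ 0 := ne_of_gt hx
    field_simp
  have hlim0 : Tendsto (fun x : ℝ => (1 - Real.exp (-a * x ^ Y)) * (-x⁻¹)) (𝓝[>] 0) (𝓝 0) := by
    have hz : Tendsto (fun x : ℝ => a * x ^ (Y - 1)) (𝓝[>] 0) (𝓝 0) := by
      have : ContinuousAt (fun x : ℝ => a * x ^ (Y - 1)) 0 :=
        (Real.continuousAt_rpow_const _ _ (Or.inr (by linarith))).const_mul a
      have h2 := this.tendsto.mono_left (nhdsWithin_le_nhds (s := Ioi 0))
      simpa [Real.zero_rpow (by linarith : Y - 1 ≠ 0)] using h2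
    refine squeeze_zero_norm' ?_ hz
    filter_upwards [self_mem_nhdsWithin] with x hx
    have hx0 : (0 : ℝ) < x := hx
    have hxY : 0 < x ^ Y := Real.rpow_pos_of_pos hx0 _
    have h1 : Real.exp (-a * x ^ Y) ≤ 1 := Real.exp_le_one_iff.2 (by nlinarith)
    have h2 := Real.add_one_le_exp (-a * x ^ Y)
    rw [norm_mul, norm_neg, norm_inv, Real.norm_of_nonneg (by linarith), Real.norm_of_nonneg hx0.le,
      Real.rpow_sub_one hx0.ne', ← div_eq_mul_inv, ← mul_div_assoc]
    gcongr
    linarith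
  have hliminf : Tendsto (fun x : ℝ => (1 - Real.exp (-a * x ^ Y)) * (-x⁻¹)) atTop (𝓝 0) := by
    refine squeeze_zero_norm' ?_ tendsto_inv_atTop_zero
    filter_upwards [eventually_gt_atTop 0] with x hx0
    have hxY : 0 < x ^ Y := Real.rpow_pos_of_pos hx0 _
    have h1 : Real.exp (-a * x ^ Y) ≤ 1 := Real.exp_le_one_iff.2 (by nlinarith)
    rw [norm_mul, norm_neg, norm_inv, Real.norm_of_nonneg (by linarith), Real.norm_of_nonneg hx0.le]
    have := inv_nonneg.2 hx0.le
    nlinarith [Real.exp_pos (-a * x ^ Y)]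
  have hint2 : IntegrableOn (fun x : ℝ => a * Y * x ^ (Y - 1) * Real.exp (-a * x ^ Y) * (-x⁻¹))
      (Ioi 0) := by
    rw [integrableOn_congr_fun hkey measurableSet_Ioi]
    exact (integrableOn_rpow_mul_exp_neg_mul_rpow (by linarith) hY0 ha).const_mul _
  have hibp := integral_Ioi_mul_deriv_eq_deriv_mul (u := fun v : ℝ => 1 - Real.exp (-a * v ^ Y))
    (v := fun v : ℝ => -v⁻¹) hder1 hder2
    (by refine hint.congr_fun (fun x _ => ?_) measurableSet_Ioi; simp [div_eq_mul_inv])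
    hint2 hlim0 hliminf
  rw [setIntegral_congr_fun measurableSet_Ioi hkey, integral_const_mul,
    integral_rpow_mul_exp_neg_mul_rpow hY0 (by linarith) ha] at hibp
  simp only [div_eq_mul_one_div (1 - Real.exp _)]
  rw [hibp]
  have h1 : (Y - 2 + 1) / Y = 1 - 1 / Y := by field_simp; ring
  have h2 : -(Y - 2 + 1) / Y = 1 / Y - 1 := by field_simp; ring
  rw [h1, h2, Real.rpow_sub_one ha.ne']
  field_simp
  ring

/-! ### The Cauchy law and its characteristic function -/

open FourierTransform in
theorem fourier_exp_neg_abs (w : ℝ) :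
    𝓕 (fun x : ℝ => ((Real.exp (-|x|) : ℝ) : ℂ)) w = 2 / (1 + (2 * Real.pi * w : ℂ) ^ 2) := by
  have e1 : ((1 : ℂ) - 2 * Real.pi * w * Complex.I) ≠ 0 := by
    intro h; simpa using congrArg Complex.re h
  have e2 : ((1 : ℂ) + 2 * Real.pi * w * Complex.I) ≠ 0 := by
    intro h; simpa using congrArg Complex.re h
  have e3 : (1 + (2 * Real.pi * w : ℂ) ^ 2)
      = (1 - 2 * Real.pi * w * Complex.I) * (1 + 2 * Real.pi * w * Complex.I) := by
    ring_nf; rw [Complex.I_sq]; ring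
  have hp : ((-1 : ℂ) - 2 * Real.pi * w * Complex.I).re < 0 := by simp
  have hn : 0 < ((1 : ℂ) - 2 * Real.pi * w * Complex.I).re := by simp
  have hpos : EqOn (fun v : ℝ => Complex.exp (((-1 : ℂ) - 2 * Real.pi * w * Complex.I) * v))
      (fun v : ℝ => Complex.exp (↑(-2 * Real.pi * inner ℝ v w) * Complex.I)
        • ((Real.exp (-|v|) : ℝ) : ℂ)) (Ioi 0) := by
    intro v hv
    simp only [abs_of_pos (mem_Ioi.1 hv), smul_eq_mul, Complex.ofReal_exp, ← Complex.exp_add]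
    congr 1
    simp
    ring
  have hneg : EqOn (fun v : ℝ => Complex.exp (((1 : ℂ) - 2 * Real.pi * w * Complex.I) * v))
      (fun v : ℝ => Complex.exp (↑(-2 * Real.pi * inner ℝ v w) * Complex.I)
        • ((Real.exp (-|v|) : ℝ) : ℂ)) (Iic 0) := by
    intro v hv
    simp only [abs_of_nonpos (mem_Iic.1 hv), smul_eq_mul, Complex.ofReal_exp, ← Complex.exp_add]
    congr 1
    simp
    ring
  rw [Real.fourier_eq', ← setIntegral_univ, ← Iic_union_Ioi (a := (0 : ℝ)),
    setIntegral_union (Iic_disjoint_Ioi le_rfl) measurableSet_Ioi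
      ((integrableOn_exp_mul_complex_Iic hn 0).congr_fun hneg measurableSet_Iic)
      ((integrableOn_exp_mul_complex_Ioi hp 0).congr_fun hpos measurableSet_Ioi),
    ← setIntegral_congr_fun measurableSet_Iic hneg, ← setIntegral_congr_fun measurableSet_Ioi hpos,
    integral_exp_mul_complex_Iic hn, integral_exp_mul_complex_Ioi hp]
  rw [show ((-1 : ℂ) - 2 * Real.pi * w * Complex.I) = -(1 + 2 * Real.pi * w * Complex.I) by ring, e3]
  simp only [Complex.ofReal_zero, mul_zero, Complex.exp_zero, neg_div_neg_eq]
  field_simp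
  ring

theorem integrable_comp_abs_of_integrableOn_Ioi {f : ℝ → ℝ} (hf : IntegrableOn f (Ioi 0)) :
    Integrable (fun x => f |x|) := by
  have h1 : IntegrableOn (fun x => f |x|) (Ioi 0) :=
    hf.congr_fun (fun x hx => by simp only [abs_of_pos (mem_Ioi.1 hx)]) measurableSet_Ioi
  have h2 : IntegrableOn (fun x => f |x|) (Iio 0) := by
    have h : IntegrableOn (fun x => f |(-x)|) (Iio 0) :=
      IntegrableOn.comp_neg_Iio (f := fun x => f |x|) (by rwa [neg_zero])
    simpa only [abs_neg] using h
  have h3 := ((integrableOn_Iic_iff_integrableOn_Iio (by simp)).2 h2).union h1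
  rwa [Iic_union_Ioi, integrableOn_univ] at h3

theorem integrable_exp_neg_abs : Integrable (fun x : ℝ => Real.exp (-|x|)) :=
  integrable_comp_abs_of_integrableOn_Ioi (integrableOn_exp_neg_Ioi 0)

open FourierTransform in
/-- The Cauchy density has characteristic function `e^{-|x|}`. -/
theorem integral_exp_I_mul_div_one_add_sq (x : ℝ) :
    ∫ u : ℝ, Complex.exp (Complex.I * u * x) * ((1 + u ^ 2)⁻¹ : ℝ) = Real.pi * Real.exp (-|x|) := by
  have hF : 𝓕 (fun x : ℝ => ((Real.exp (-|x|) : ℝ) : ℂ))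
      = fun w : ℝ => 2 * (((1 + (2 * Real.pi * w) ^ 2)⁻¹ : ℝ) : ℂ) := by
    ext w
    rw [fourier_exp_neg_abs]
    push_cast
    rw [div_eq_mul_inv]
  have hI : Integrable (𝓕 (fun x : ℝ => ((Real.exp (-|x|) : ℝ) : ℂ))) := by
    rw [hF]
    exact ((integrable_inv_one_add_sq.comp_mul_left' Real.two_pi_pos.ne').ofReal).const_mul 2
  have hc : Continuous (fun x : ℝ => ((Real.exp (-|x|) : ℝ) : ℂ)) := by fun_prop
  have hf : Integrable (fun x : ℝ => ((Real.exp (-|x|) : ℝ) : ℂ)) := integrable_exp_neg_abs.ofReal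
  have hinv := hf.fourierInv_fourier_eq hI (v := x)
    hc.continuousAt
  rw [hF, Real.fourierInv_eq'] at hinv
  -- The Fourier transform is normalised with `2π` in the exponent; the substitution `u = 2πw`
  -- removes it.
  have hsub := Measure.integral_comp_mul_left
    (fun u : ℝ => Complex.exp (Complex.I * u * x) * ((1 + u ^ 2)⁻¹ : ℝ)) (2 * Real.pi)
  have he : ∀ w : ℝ, Complex.exp (↑(2 * Real.pi * inner ℝ w x) * Complex.I)
      • (2 * (((1 + (2 * Real.pi * w) ^ 2)⁻¹ : ℝ) : ℂ))
      = 2 * (Complex.exp (Complex.I * (2 * Real.pi * w : ℝ) * x)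
        * ((1 + (2 * Real.pi * w) ^ 2)⁻¹ : ℝ)) := by
    intro w
    simp only [smul_eq_mul]
    rw [show (↑(2 * Real.pi * inner ℝ w x) * Complex.I : ℂ)
      = Complex.I * (2 * Real.pi * w : ℝ) * x by simp; ring]
    ring
  simp_rw [he] at hinv
  rw [integral_const_mul, hsub, abs_of_pos (inv_pos.2 Real.two_pi_pos)] at hinv
  have hpi : (Real.pi : ℂ) ≠ 0 := Complex.ofReal_ne_zero.2 Real.pi_ne_zero
  change _ = ((Real.exp (-|x|) : ℝ) : ℂ) at hinv
  rw [← hinv, Complex.real_smul]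
  generalize (∫ u : ℝ, Complex.exp (Complex.I * u * x) * ((1 + u ^ 2)⁻¹ : ℝ)) = J
  push_cast
  field_simp

theorem integral_cos_mul_div_one_add_sq (x : ℝ) :
    ∫ u : ℝ, Real.cos (u * x) * (1 + u ^ 2)⁻¹ = Real.pi * Real.exp (-|x|) := by
  have h := integral_exp_I_mul_div_one_add_sq x
  have hint : Integrable fun u : ℝ => Complex.exp (Complex.I * u * x) * ((1 + u ^ 2)⁻¹ : ℝ) := by
    refine (integrable_inv_one_add_sq.ofReal (𝕜 := ℂ)).bdd_mul (c := 1)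
      (Measurable.aestronglyMeasurable (by fun_prop)) (ae_of_all _ fun u => ?_)
    rw [Complex.norm_exp]
    simp
  have h2 : ∀ u : ℝ, Real.cos (u * x) * (1 + u ^ 2)⁻¹
      = RCLike.re (Complex.exp (Complex.I * u * x) * ((1 + u ^ 2)⁻¹ : ℝ)) := by
    intro u
    rw [RCLike.re_to_complex, Complex.re_mul_ofReal, Complex.exp_re]
    simp
  simp_rw [h2]
  rw [integral_re hint, h, RCLike.re_to_complex, ← Complex.ofReal_mul, Complex.ofReal_re]

/-! ### The exponent of the symmetric stable law -/

theorem integral_exp_neg_mul_cos {s : ℝ} (hs : 0 < s) :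
    ∫ x in Ioi (0 : ℝ), Real.exp (-s * x) * Real.cos x = s / (1 + s ^ 2) := by
  have ha : ((-s : ℂ) + Complex.I).re < 0 := by simpa using hs
  have h := integral_exp_mul_complex_Ioi ha 0
  have hint := integrableOn_exp_mul_complex_Ioi ha 0
  have h2 : ∀ x : ℝ, Real.exp (-s * x) * Real.cos x
      = RCLike.re (Complex.exp (((-s : ℂ) + Complex.I) * x)) := by
    intro x
    simp [Complex.exp_re]
  simp_rw [h2]
  rw [integral_re hint, h]
  simp [Complex.div_re, Complex.normSq_apply]
  field_simp
  ring

theorem integral_exp_neg_mul_one_sub_cos {s : ℝ} (hs : 0 < s) :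
    ∫ x in Ioi (0 : ℝ), Real.exp (-s * x) * (1 - Real.cos x) = 1 / (s * (1 + s ^ 2)) := by
  have h1 : IntegrableOn (fun x => Real.exp (-s * x)) (Ioi 0) :=
    integrableOn_exp_mul_Ioi (neg_lt_zero.2 hs) 0
  have h2 : IntegrableOn (fun x => Real.exp (-s * x) * Real.cos x) (Ioi 0) :=
    h1.mul_bdd (c := 1) (Measurable.aestronglyMeasurable (by fun_prop))
      (ae_of_all _ fun x => by simpa using Real.abs_cos_le_one x)
  simp_rw [mul_sub, mul_one]
  rw [integral_sub h1 h2, integral_exp_mul_Ioi (neg_lt_zero.2 hs), integral_exp_neg_mul_cos hs]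
  simp
  field_simp
  ring

theorem integrableOn_exp_neg_mul_one_sub_cos {s : ℝ} (hs : 0 < s) :
    IntegrableOn (fun x => Real.exp (-s * x) * (1 - Real.cos x)) (Ioi 0) := by
  have h1 : IntegrableOn (fun x => Real.exp (-s * x)) (Ioi 0) :=
    integrableOn_exp_mul_Ioi (neg_lt_zero.2 hs) 0
  refine h1.mul_bdd (c := 2) (Measurable.aestronglyMeasurable (by fun_prop))
      (ae_of_all _ fun x => ?_)
  rw [Real.norm_of_nonneg (by linarith [Real.cos_le_one x])]
  linarith [Real.neg_one_le_cos x]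

theorem integrableOn_rpow_div_one_add_sq {Y : ℝ} (h0 : 0 < Y) (h2 : Y < 2) :
    IntegrableOn (fun s : ℝ => s ^ (Y - 1) / (1 + s ^ 2)) (Ioi 0) := by
  refine integrableOn_Ioi_zero_of_rpow_bounds (A := 1) (B := 1) (p := Y - 1) (q := Y - 3)
    (Measurable.aestronglyMeasurable (by fun_prop)) (by linarith) (by linarith)
    (fun x hx _ => ?_) (fun x hx => ?_)
  · have := Real.rpow_nonneg hx.le (Y - 1)
    rw [Real.norm_of_nonneg (by positivity), one_mul]
    exact div_le_self this (by nlinarith)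
  · have hx0 : 0 < x := by linarith
    have := Real.rpow_nonneg hx0.le (Y - 1)
    rw [Real.norm_of_nonneg (by positivity), one_mul,
      show Y - 3 = Y - 1 - 2 by ring, Real.rpow_sub hx0 (Y - 1), Real.rpow_two]
    gcongr
    linarith

/-- Write `1/(1 + s²) = ∫₀^∞ e^{-(1+s²)r} dr` and swap: the inner integral becomes a Gaussian
moment, the outer one a Gamma integral, and the reflection formula evaluates `Γ(Y/2) Γ(1 - Y/2)`. -/
theorem integral_rpow_div_one_add_sq {Y : ℝ} (h0 : 0 < Y) (h2 : Y < 2) :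
    ∫ s in Ioi (0 : ℝ), s ^ (Y - 1) / (1 + s ^ 2) = Real.pi / (2 * Real.sin (Real.pi * Y / 2)) := by
  have hinner : ∀ s ∈ Ioi (0 : ℝ),
      ∫ r in Ioi (0 : ℝ), s ^ (Y - 1) * Real.exp (-(1 + s ^ 2) * r) = s ^ (Y - 1) / (1 + s ^ 2) := by
    intro s _
    rw [integral_const_mul, integral_exp_mul_Ioi (by nlinarith)]
    rw [mul_zero, Real.exp_zero, neg_div_neg_eq, mul_one_div]
  have hinner2 : ∀ r ∈ Ioi (0 : ℝ),
      ∫ s in Ioi (0 : ℝ), s ^ (Y - 1) * Real.exp (-(1 + s ^ 2) * r)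
        = Real.Gamma (Y / 2) / 2 * (Real.exp (-r) * r ^ ((1 - Y / 2) - 1)) := by
    intro r hr
    have : ∀ s : ℝ, s ^ (Y - 1) * Real.exp (-(1 + s ^ 2) * r)
        = Real.exp (-r) * (s ^ (Y - 1) * Real.exp (-r * s ^ (2 : ℝ))) := by
      intro s
      rw [mul_left_comm, ← Real.exp_add, Real.rpow_two]
      ring_nf
    simp_rw [this]
    rw [integral_const_mul, integral_rpow_mul_exp_neg_mul_rpow two_pos (by linarith) hr]
    ring_nf
  have hprod : Integrable (Function.uncurry fun s r : ℝ => s ^ (Y - 1) * Real.exp (-(1 + s ^ 2) * r))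
      ((volume.restrict (Ioi 0)).prod (volume.restrict (Ioi 0))) := by
    rw [integrable_prod_iff (Measurable.aestronglyMeasurable (by unfold Function.uncurry; fun_prop))]
    refine ⟨(ae_restrict_iff' measurableSet_Ioi).2 (ae_of_all _ fun s _ => ?_), ?_⟩
    · exact (integrableOn_exp_mul_Ioi (a := -(1 + s ^ 2)) (by nlinarith) 0).const_mul (s ^ (Y - 1))
    · refine (integrableOn_rpow_div_one_add_sq h0 h2).congr_fun (fun s hs => ?_) measurableSet_Ioi
      refine (hinner s hs).symm.trans ?_
      refine integral_congr_ae (ae_of_all _ fun r => ?_)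
      simp [abs_of_nonneg (Real.rpow_nonneg (le_of_lt hs) _)]
  rw [← setIntegral_congr_fun measurableSet_Ioi hinner, integral_integral_swap hprod,
    setIntegral_congr_fun measurableSet_Ioi hinner2, integral_const_mul,
    ← Real.Gamma_eq_integral (by linarith), div_mul_eq_mul_div, Real.Gamma_mul_Gamma_one_sub]
  rw [div_div, mul_comm (Real.sin _), mul_div_assoc]

/-- Write `Γ(1+Y) x^{-(1+Y)} = ∫₀^∞ s^Y e^{-sx} ds` and swap; the Laplace transform of `1 - cos`
reduces the claim to `integral_rpow_div_one_add_sq`. -/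
theorem integral_one_sub_cos_mul_rpow {Y : ℝ} (h0 : 0 < Y) (h2 : Y < 2) :
    ∫ x in Ioi (0 : ℝ), (1 - Real.cos x) * x ^ (-(1 + Y))
      = Real.pi / (2 * Real.sin (Real.pi * Y / 2)) / Real.Gamma (1 + Y) := by
  have hinner : ∀ x ∈ Ioi (0 : ℝ),
      ∫ s in Ioi (0 : ℝ), s ^ Y * (Real.exp (-s * x) * (1 - Real.cos x))
        = Real.Gamma (1 + Y) * ((1 - Real.cos x) * x ^ (-(1 + Y))) := by
    intro x hx
    have h := Real.integral_rpow_mul_exp_neg_mul_Ioi (a := 1 + Y) (by linarith) (mem_Ioi.1 hx)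
    simp_rw [← mul_assoc]
    rw [integral_mul_const]
    have h3 : ∀ s : ℝ, s ^ Y * Real.exp (-s * x) = s ^ (1 + Y - 1) * Real.exp (-(x * s)) := by
      intro s; ring_nf
    simp_rw [h3]
    rw [h, one_div, Real.inv_rpow (le_of_lt hx), Real.rpow_neg (le_of_lt hx)]
    ring
  have hinner2 : ∀ s ∈ Ioi (0 : ℝ),
      ∫ x in Ioi (0 : ℝ), s ^ Y * (Real.exp (-s * x) * (1 - Real.cos x))
        = s ^ (Y - 1) / (1 + s ^ 2) := by
    intro s hs
    have hs' : s ≠ 0 := ne_of_gt hs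
    rw [integral_const_mul, integral_exp_neg_mul_one_sub_cos hs, Real.rpow_sub_one hs']
    field_simp
  have hprod : Integrable
      (Function.uncurry fun s x : ℝ => s ^ Y * (Real.exp (-s * x) * (1 - Real.cos x)))
      ((volume.restrict (Ioi 0)).prod (volume.restrict (Ioi 0))) := by
    rw [integrable_prod_iff (Measurable.aestronglyMeasurable (by unfold Function.uncurry; fun_prop))]
    refine ⟨(ae_restrict_iff' measurableSet_Ioi).2 (ae_of_all _ fun s hs => ?_), ?_⟩
    · exact (integrableOn_exp_neg_mul_one_sub_cos hs).const_mul (s ^ Y)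
    · refine (integrableOn_rpow_div_one_add_sq h0 h2).congr_fun (fun s hs => ?_) measurableSet_Ioi
      refine (hinner2 s hs).symm.trans ?_
      refine integral_congr_ae (ae_of_all _ fun r => ?_)
      have h1 := Real.rpow_nonneg (le_of_lt hs) Y
      have h2 : 0 ≤ 1 - Real.cos r := by linarith [Real.cos_le_one r]
      simp [abs_of_nonneg h1, abs_of_nonneg h2]
  have hG : Real.Gamma (1 + Y) ≠ 0 := (Real.Gamma_pos_of_pos (by linarith)).ne'
  rw [eq_div_iff hG, mul_comm, ← integral_const_mul,
    ← setIntegral_congr_fun measurableSet_Ioi hinner, ← integral_integral_swap hprod,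
    setIntegral_congr_fun measurableSet_Ioi hinner2, integral_rpow_div_one_add_sq h0 h2]

/-- `∫₀^∞ (1 - cos x) x^{-1-Y} dx = Γ(-Y) |cos(πY/2)|` for `1 < Y < 2`. -/
theorem integral_one_sub_cos_mul_rpow_eq_Gamma_neg {Y : ℝ} (h1 : 1 < Y) (h2 : Y < 2) :
    ∫ x in Ioi (0 : ℝ), (1 - Real.cos x) * x ^ (-(1 + Y))
      = Real.Gamma (-Y) * |Real.cos (Real.pi * Y / 2)| := by
  have hpi := Real.pi_pos
  have hcos : Real.cos (Real.pi * Y / 2) < 0 :=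
    Real.cos_neg_of_pi_div_two_lt_of_lt (by nlinarith) (by nlinarith)
  have hsin : 0 < Real.sin (Real.pi * Y / 2) :=
    Real.sin_pos_of_pos_of_lt_pi (by positivity) (by nlinarith)
  have hG : 0 < Real.Gamma (1 + Y) := Real.Gamma_pos_of_pos (by linarith)
  -- Reflection at `-Y` converts `1/Γ(1+Y)` into `Γ(-Y)`. Doubling the angle cancels the sine, and
  -- the remaining minus sign is absorbed by `|cos|`, the cosine being negative.
  have h := Real.Gamma_mul_Gamma_one_sub (-Y)
  rw [sub_neg_eq_add, show Real.pi * -Y = -(2 * (Real.pi * Y / 2)) by ring, Real.sin_neg,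
    Real.sin_two_mul] at h
  rw [integral_one_sub_cos_mul_rpow (by linarith) h2, abs_of_neg hcos, eq_div_of_mul_eq hG.ne' h]
  have hcos' := hcos.ne
  field_simp

theorem integral_one_sub_cos_mul_mul_rpow {Y : ℝ} (h1 : 1 < Y) (h2 : Y < 2) (u : ℝ) :
    ∫ x in Ioi (0 : ℝ), (1 - Real.cos (u * x)) * x ^ (-(1 + Y))
      = Real.Gamma (-Y) * |Real.cos (Real.pi * Y / 2)| * |u| ^ Y := by
  rcases eq_or_ne u 0 with rfl | hu
  · simp [Real.zero_rpow (by linarith : Y ≠ 0)]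
  have hu' : 0 < |u| := abs_pos.2 hu
  have h := integral_comp_mul_left_Ioi (fun x : ℝ => (1 - Real.cos x) * x ^ (-(1 + Y))) 0 hu'
  rw [mul_zero, integral_one_sub_cos_mul_rpow_eq_Gamma_neg h1 h2] at h
  have h3 : ∀ x ∈ Ioi (0 : ℝ), (1 - Real.cos (|u| * x)) * (|u| * x) ^ (-(1 + Y))
      = |u| ^ (-(1 + Y)) * ((1 - Real.cos (u * x)) * x ^ (-(1 + Y))) := by
    intro x hx
    have hc : Real.cos (|u| * x) = Real.cos (u * x) := by
      rw [← Real.cos_abs (u * x), abs_mul, abs_of_pos (mem_Ioi.1 hx)]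
    rw [hc, Real.mul_rpow hu'.le (le_of_lt hx)]
    ring
  rw [setIntegral_congr_fun measurableSet_Ioi h3, integral_const_mul, Real.rpow_neg hu'.le,
    Real.rpow_add hu', Real.rpow_one, smul_eq_mul] at h
  have hY : 0 < |u| ^ Y := Real.rpow_pos_of_pos hu' _
  field_simp at h
  rw [h, mul_comm Real.pi Y]
  ring

/-! ### Estimates for the Lévy–Khintchine kernel -/

/-- The compensated kernel `e^{iux} - 1 - i u x 1_{|x| ≤ 1}` of the Lévy–Khintchine formula. -/
noncomputable def levyKernel (u x : ℝ) : ℂ :=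
  Complex.exp (Complex.I * u * x) - 1 - Complex.I * u * (if |x| ≤ 1 then (x : ℂ) else 0)

@[fun_prop]
theorem measurable_levyKernel (u : ℝ) : Measurable (levyKernel u) := by
  unfold levyKernel
  refine Measurable.sub (by fun_prop) (Measurable.const_mul ?_ _)
  exact Measurable.ite (measurableSet_le (by fun_prop) (by fun_prop)) (by fun_prop) (by fun_prop)

theorem norm_exp_I_mul_sub_one_le (u x : ℝ) :
    ‖Complex.exp (Complex.I * u * x) - 1‖ ≤ |u * x| := by
  have := Real.norm_exp_I_mul_ofReal_sub_one_le (x := u * x)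
  simpa [mul_assoc] using this

theorem norm_exp_I_mul (u x : ℝ) : ‖Complex.exp (Complex.I * u * x)‖ = 1 := by
  rw [Complex.norm_exp]; simp

theorem norm_levyKernel_le_of_abs_le_one {u x : ℝ} (hx : |x| ≤ 1) :
    ‖levyKernel u x‖ ≤ 2 * u ^ 2 * |x| ^ 2 := by
  have hz : ‖Complex.I * u * x‖ = |u * x| := by simp [abs_mul]
  have e : 2 * u ^ 2 * |x| ^ 2 = 2 * |u * x| ^ 2 := by rw [abs_mul, mul_pow, sq_abs, sq_abs]; ring
  rw [levyKernel, if_pos hx, e]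
  rcases le_or_gt |u * x| 1 with h | h
  · have := Complex.norm_exp_sub_one_sub_id_le (x := Complex.I * u * x) (by rwa [hz])
    rw [hz] at this
    nlinarith [sq_nonneg |u * x|]
  · have h1 := norm_sub_le (Complex.exp (Complex.I * u * x) - 1) (Complex.I * u * x)
    have h2 := norm_exp_I_mul_sub_one_le u x
    rw [hz] at h1
    nlinarith

theorem norm_levyKernel_le_of_one_lt_abs {u x : ℝ} (hx : 1 < |x|) : ‖levyKernel u x‖ ≤ 2 := by
  rw [levyKernel, if_neg (not_le.2 hx), mul_zero, sub_zero]
  have := norm_sub_le (Complex.exp (Complex.I * u * x)) 1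
  rw [norm_exp_I_mul, norm_one] at this
  linarith

/-- Factoring out `e^{ivx}` costs only one power of `|x|`, so integrating against a density with
finite first absolute moment gives a Lipschitz function of `u`. -/
theorem norm_levyKernel_sub_le (u v x : ℝ) :
    ‖levyKernel u x - levyKernel v x‖ ≤ 2 * |u - v| * |x| := by
  have e : levyKernel u x - levyKernel v x
      = Complex.exp (Complex.I * v * x) * (Complex.exp (Complex.I * (u - v : ℝ) * x) - 1)
        - Complex.I * (u - v : ℝ) * (if |x| ≤ 1 then (x : ℂ) else 0) := by
    rw [mul_sub, ← Complex.exp_add, levyKernel, levyKernel]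
    push_cast
    ring_nf
  rw [e]
  refine (norm_sub_le _ _).trans ?_
  have h1 := norm_exp_I_mul_sub_one_le (u - v) x
  have h2 : ‖(if |x| ≤ 1 then (x : ℂ) else 0)‖ ≤ |x| := by
    split_ifs
    · simp
    · simp
  rw [norm_mul, norm_exp_I_mul, one_mul, norm_mul, norm_mul, Complex.norm_I, one_mul,
    Complex.norm_real, Real.norm_eq_abs]
  rw [abs_mul] at h1
  nlinarith [mul_le_mul_of_nonneg_left h2 (abs_nonneg (u - v))]

theorem levyKernel_re (u x : ℝ) : (levyKernel u x).re = Real.cos (u * x) - 1 := by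
  rw [levyKernel]
  split_ifs <;> simp [Complex.exp_re]

/-- Symmetrising removes the sine and the compensator, both odd in `x`. -/
theorem levyKernel_add_neg (u x : ℝ) :
    levyKernel u x + levyKernel u (-x) = ((-(2 * (1 - Real.cos (u * x))) : ℝ) : ℂ) := by
  have h1 : Complex.exp (Complex.I * u * x) = Complex.cos (u * x) + Complex.sin (u * x) * Complex.I := by
    rw [← Complex.exp_mul_I]; ring_nf
  have h2 : Complex.exp (Complex.I * u * (-x))
      = Complex.cos (u * x) - Complex.sin (u * x) * Complex.I := by
    rw [show Complex.I * u * (-x : ℂ) = (-(u * x) : ℂ) * Complex.I by ring, Complex.exp_mul_I,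
      Complex.cos_neg, Complex.sin_neg]
    ring
  simp only [levyKernel, abs_neg]
  push_cast
  rw [h1, h2]
  split_ifs <;> ring

/-! ### Comparison of the CGMY and stable exponents -/

/-- The symmetric `Y`-stable Lévy density `C |x|^{-1-Y}`. -/
noncomputable def stableDensity (C Y x : ℝ) : ℝ := C * |x| ^ (-(1 + Y))

@[fun_prop]
theorem measurable_stableDensity (C Y : ℝ) : Measurable (stableDensity C Y) := by
  unfold stableDensity; fun_prop

@[fun_prop]
theorem measurable_cgmyDensity (C G M Y : ℝ) : Measurable (cgmyDensity C G M Y) := by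
  unfold cgmyDensity
  refine Measurable.ite measurableSet_Iio (by fun_prop) (Measurable.ite measurableSet_Ioi ?_ ?_) <;>
    fun_prop

section
variable {C G M Y : ℝ}

theorem stableDensity_nonneg (hC : 0 < C) (x : ℝ) : 0 ≤ stableDensity C Y x :=
  mul_nonneg hC.le (Real.rpow_nonneg (abs_nonneg x) _)

theorem cgmyDensity_nonneg (hC : 0 < C) (x : ℝ) : 0 ≤ cgmyDensity C G M Y x := by
  unfold cgmyDensity
  split_ifs with h1 h2
  · positivity
  · positivity
  · exact le_rfl

theorem cgmyDensity_of_neg {x : ℝ} (hx : x < 0) :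
    cgmyDensity C G M Y x = stableDensity C Y x * Real.exp (-G * |x|) := by
  rw [cgmyDensity, if_pos hx, stableDensity, Real.rpow_neg (abs_nonneg x)]
  ring

theorem cgmyDensity_of_pos {x : ℝ} (hx : 0 < x) :
    cgmyDensity C G M Y x = stableDensity C Y x * Real.exp (-M * |x|) := by
  rw [cgmyDensity, if_neg hx.le.not_gt, if_pos hx, stableDensity, Real.rpow_neg (abs_nonneg x),
    abs_of_pos hx]
  ring

theorem stableDensity_zero (hY : 0 < Y) : stableDensity C Y 0 = 0 := by
  rw [stableDensity, abs_zero, Real.zero_rpow (by linarith), mul_zero]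

theorem cgmyDensity_zero : cgmyDensity C G M Y 0 = 0 := by simp [cgmyDensity]

theorem cgmyDensity_le_stableDensity (hC : 0 < C) (hG : 0 ≤ G) (hM : 0 ≤ M) (hY : 0 < Y) (x : ℝ) :
    cgmyDensity C G M Y x ≤ stableDensity C Y x := by
  rcases lt_trichotomy x 0 with h | rfl | h
  · rw [cgmyDensity_of_neg h]
    exact mul_le_of_le_one_right (stableDensity_nonneg hC x)
      (Real.exp_le_one_iff.2 (by nlinarith [abs_nonneg x]))
  · rw [stableDensity_zero hY, cgmyDensity_zero]
  · rw [cgmyDensity_of_pos h]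
    exact mul_le_of_le_one_right (stableDensity_nonneg hC x)
      (Real.exp_le_one_iff.2 (by nlinarith [abs_nonneg x]))

/-- The single rate `G + M` dominates the tempering on both half-lines and makes the bound even in
`x`. -/
theorem stableDensity_sub_cgmyDensity_le (hC : 0 < C) (hG : 0 ≤ G) (hM : 0 ≤ M) (hY : 0 < Y)
    (x : ℝ) : stableDensity C Y x - cgmyDensity C G M Y x
      ≤ stableDensity C Y x * (1 - Real.exp (-(G + M) * |x|)) := by
  have hs := stableDensity_nonneg (Y := Y) hC x
  have hx := abs_nonneg x
  rcases lt_trichotomy x 0 with h | rfl | h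
  · rw [cgmyDensity_of_neg h, mul_sub, mul_one]
    gcongr
    linarith
  · simp [stableDensity_zero hY, cgmyDensity_zero]
  · rw [cgmyDensity_of_pos h, mul_sub, mul_one]
    gcongr
    linarith

/-- The tempering defect `1 - e^{-(G+M)|x|}` gains a power of `|x|` at the origin: the integrand is
`O(|x|^(1-Y))` there, integrable as `Y < 2`, and `O(|x|^(-Y))` at infinity, integrable as `Y > 1`.
-/
theorem integrable_stableDensity_sub_cgmyDensity_mul_abs (hC : 0 < C) (hG : 0 ≤ G) (hM : 0 ≤ M)
    (h1 : 1 < Y) (h2 : Y < 2) :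
    Integrable fun x => (stableDensity C Y x - cgmyDensity C G M Y x) * |x| := by
  have hY : 0 < Y := by linarith
  have hg : IntegrableOn
      (fun y : ℝ => C * y ^ (-(1 + Y)) * (1 - Real.exp (-(G + M) * y)) * y) (Ioi 0) := by
    refine integrableOn_Ioi_zero_of_rpow_bounds (A := C * (G + M)) (B := C) (p := 1 - Y) (q := -Y)
      (Measurable.aestronglyMeasurable (by fun_prop)) (by linarith) (by linarith)
      (fun x hx _ => ?_) (fun x hx => ?_)
    · have hp := Real.rpow_nonneg hx.le (-(1 + Y))
      have h3 := Real.add_one_le_exp (-(G + M) * x)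
      have h4 : Real.exp (-(G + M) * x) ≤ 1 := Real.exp_le_one_iff.2 (by nlinarith)
      have h5 : 0 ≤ 1 - Real.exp (-(G + M) * x) := by linarith
      rw [Real.norm_of_nonneg (by positivity),
        show 1 - Y = -(1 + Y) + 1 + 1 by ring, Real.rpow_add_one hx.ne', Real.rpow_add_one hx.ne']
      calc C * x ^ (-(1 + Y)) * (1 - Real.exp (-(G + M) * x)) * x
          ≤ C * x ^ (-(1 + Y)) * ((G + M) * x) * x := by gcongr; linarith
        _ = _ := by ring
    · have hx0 : 0 < x := by linarith
      have hp := Real.rpow_nonneg hx0.le (-(1 + Y))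
      have h4 : Real.exp (-(G + M) * x) ≤ 1 := Real.exp_le_one_iff.2 (by nlinarith)
      have h5 : 0 ≤ 1 - Real.exp (-(G + M) * x) := by linarith
      rw [Real.norm_of_nonneg (by positivity),
        show -Y = -(1 + Y) + 1 by ring, Real.rpow_add_one hx0.ne']
      calc C * x ^ (-(1 + Y)) * (1 - Real.exp (-(G + M) * x)) * x
          ≤ C * x ^ (-(1 + Y)) * 1 * x := by gcongr; linarith [Real.exp_pos (-(G + M) * x)]
        _ = _ := by ring
  refine (integrable_comp_abs_of_integrableOn_Ioi hg).mono'
    (Measurable.aestronglyMeasurable (by fun_prop)) (ae_of_all _ fun x => ?_)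
  rw [Real.norm_of_nonneg (mul_nonneg
    (sub_nonneg.2 (cgmyDensity_le_stableDensity hC hG hM hY x)) (abs_nonneg x))]
  exact mul_le_mul_of_nonneg_right (stableDensity_sub_cgmyDensity_le hC hG hM hY x) (abs_nonneg x)

theorem integrable_stableDensity_mul_levyKernel (hC : 0 < C) (h1 : 0 < Y) (h2 : Y < 2) (u : ℝ) :
    Integrable fun x => (stableDensity C Y x : ℂ) * levyKernel u x := by
  have hg : IntegrableOn
      (fun y : ℝ => C * y ^ (-(1 + Y)) * (if y ≤ 1 then 2 * u ^ 2 * y ^ 2 else 2)) (Ioi 0) := by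
    refine integrableOn_Ioi_zero_of_rpow_bounds (A := C * (2 * u ^ 2)) (B := C * 2) (p := 1 - Y)
      (q := -(1 + Y)) (Measurable.aestronglyMeasurable (Measurable.mul (by fun_prop)
        (Measurable.ite measurableSet_Iic (by fun_prop) (by fun_prop)))) (by linarith) (by linarith)
      (fun x hx hx1 => ?_) (fun x hx => ?_)
    · have hp := Real.rpow_nonneg hx.le (-(1 + Y))
      rw [if_pos hx1, Real.norm_of_nonneg (by positivity),
        show 1 - Y = -(1 + Y) + 1 + 1 by ring, Real.rpow_add_one hx.ne', Real.rpow_add_one hx.ne']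
      exact le_of_eq (by ring)
    · have hp := Real.rpow_nonneg (zero_le_one.trans hx.le) (-(1 + Y))
      rw [if_neg hx.not_ge, Real.norm_of_nonneg (by positivity)]
      exact le_of_eq (by ring)
  refine (integrable_comp_abs_of_integrableOn_Ioi hg).mono'
    (Measurable.aestronglyMeasurable (by fun_prop)) (ae_of_all _ fun x => ?_)
  have hs := stableDensity_nonneg (Y := Y) hC x
  rw [norm_mul, Complex.norm_real, Real.norm_of_nonneg hs]
  refine mul_le_mul_of_nonneg_left ?_ hs
  split_ifs with h
  · exact norm_levyKernel_le_of_abs_le_one h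
  · exact norm_levyKernel_le_of_one_lt_abs (not_le.1 h)

/-- The density is even, so the kernel may be averaged over `x` and `-x`; what remains is the cosine
integral. -/
theorem integral_stableDensity_mul_levyKernel (hC : 0 < C) (h1 : 1 < Y) (h2 : Y < 2) (u : ℝ) :
    ∫ x, (stableDensity C Y x : ℂ) * levyKernel u x
      = ((-(2 * C * Real.Gamma (-Y) * |Real.cos (Real.pi * Y / 2)| * |u| ^ Y) : ℝ) : ℂ) := by
  have hint := integrable_stableDensity_mul_levyKernel hC (by linarith : 0 < Y) h2 u
  have hneg := integral_neg_eq_self (fun x => (stableDensity C Y x : ℂ) * levyKernel u x) volume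
  have hsum := integral_add hint hint.comp_neg
  rw [hneg] at hsum
  have hpt : ∀ x : ℝ, (stableDensity C Y x : ℂ) * levyKernel u x
      + (stableDensity C Y (-x) : ℂ) * levyKernel u (-x)
      = (((-2 * C) * ((1 - Real.cos (u * |x|)) * |x| ^ (-(1 + Y))) : ℝ) : ℂ) := by
    intro x
    have hc : Real.cos (u * |x|) = Real.cos (u * x) := by
      rw [← Real.cos_abs, ← Real.cos_abs (u * x), abs_mul, abs_abs, abs_mul]
    rw [show stableDensity C Y (-x) = stableDensity C Y x by simp [stableDensity], ← mul_add,
      levyKernel_add_neg, hc, stableDensity]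
    push_cast
    ring
  simp_rw [hpt] at hsum
  rw [integral_complex_ofReal, integral_const_mul,
    integral_comp_abs (f := fun y : ℝ => (1 - Real.cos (u * y)) * y ^ (-(1 + Y))),
    integral_one_sub_cos_mul_mul_rpow h1 h2] at hsum
  have h3 : ∀ z w : ℂ, w = z + z → z = w / 2 := fun z w h => by rw [h]; ring
  rw [h3 _ _ hsum]
  push_cast
  ring

theorem integrable_cgmyDensity_mul_levyKernel (hC : 0 < C) (hG : 0 ≤ G) (hM : 0 ≤ M)
    (h1 : 1 < Y) (h2 : Y < 2) (u : ℝ) :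
    Integrable fun x => (cgmyDensity C G M Y x : ℂ) * levyKernel u x := by
  refine (integrable_stableDensity_mul_levyKernel hC (by linarith : 0 < Y) h2 u).mono
    (Measurable.aestronglyMeasurable (by fun_prop)) (ae_of_all _ fun x => ?_)
  rw [norm_mul, norm_mul, Complex.norm_real, Complex.norm_real,
    Real.norm_of_nonneg (cgmyDensity_nonneg hC x), Real.norm_of_nonneg (stableDensity_nonneg hC x)]
  exact mul_le_mul_of_nonneg_right (cgmyDensity_le_stableDensity hC hG hM (by linarith) x)
    (norm_nonneg _)

theorem levyKhintchineExponent_cgmy (hC : 0 < C) (b u : ℝ) :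
    levyKhintchineExponent b 0 (cgmyLevyMeasure C G M Y) u
      = Complex.I * u * b + ∫ x, (cgmyDensity C G M Y x : ℂ) * levyKernel u x := by
  rw [levyKhintchineExponent, cgmyLevyMeasure,
    integral_withDensity_eq_integral_toReal_smul (by fun_prop) (by simp)]
  congr 1
  · simp
  · refine integral_congr_ae (ae_of_all _ fun x => ?_)
    simp only
    rw [ENNReal.toReal_ofReal (cgmyDensity_nonneg hC x), Complex.real_smul]
    rfl

/-- The CGMY exponent differs from that of the symmetric `Y`-stable law by a Lipschitz function. -/
theorem exists_lipschitz_levyKhintchineExponent_add_rpow (hC : 0 < C) (hG : 0 ≤ G) (hM : 0 ≤ M)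
    (h1 : 1 < Y) (h2 : Y < 2) (b : ℝ) :
    ∃ K : ℝ≥0, LipschitzWith K fun u : ℝ =>
      levyKhintchineExponent b 0 (cgmyLevyMeasure C G M Y) u
        + ((2 * C * Real.Gamma (-Y) * |Real.cos (Real.pi * Y / 2)| * |u| ^ Y : ℝ) : ℂ) := by
  set D : ℝ → ℝ := fun x => stableDensity C Y x - cgmyDensity C G M Y x with hD
  have hDnn : ∀ x, 0 ≤ D x := fun x =>
    sub_nonneg.2 (cgmyDensity_le_stableDensity hC hG hM (by linarith) x)
  have hDint := integrable_stableDensity_sub_cgmyDensity_mul_abs hC hG hM h1 h2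
  have hJ : 0 ≤ ∫ x, D x * |x| := integral_nonneg fun x => mul_nonneg (hDnn x) (abs_nonneg x)
  have hDk : ∀ u, Integrable fun x => (D x : ℂ) * levyKernel u x := by
    intro u
    have := (integrable_stableDensity_mul_levyKernel hC (by linarith : 0 < Y) h2 u).sub
      (integrable_cgmyDensity_mul_levyKernel hC hG hM h1 h2 u)
    refine this.congr (ae_of_all _ fun x => ?_)
    simp [hD, sub_mul]
  -- The stable part cancels the added power exactly, leaving the drift and the integral against the
  -- density difference `D`.
  have hrem : ∀ u : ℝ, levyKhintchineExponent b 0 (cgmyLevyMeasure C G M Y) u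
        + ((2 * C * Real.Gamma (-Y) * |Real.cos (Real.pi * Y / 2)| * |u| ^ Y : ℝ) : ℂ)
      = Complex.I * u * b - ∫ x, (D x : ℂ) * levyKernel u x := by
    intro u
    have hs : ∀ x, (D x : ℂ) * levyKernel u x = (stableDensity C Y x : ℂ) * levyKernel u x
        - (cgmyDensity C G M Y x : ℂ) * levyKernel u x := fun x => by simp [hD, sub_mul]
    simp_rw [hs]
    rw [levyKhintchineExponent_cgmy hC, integral_sub
      (integrable_stableDensity_mul_levyKernel hC (by linarith : 0 < Y) h2 u)
      (integrable_cgmyDensity_mul_levyKernel hC hG hM h1 h2 u),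
      integral_stableDensity_mul_levyKernel hC h1 h2]
    push_cast
    ring
  -- The drift contributes `|b|`; the factor `2` comes from `norm_levyKernel_sub_le`.
  refine ⟨(|b| + 2 * ∫ x, D x * |x|).toNNReal, LipschitzWith.of_dist_le_mul fun u v => ?_⟩
  rw [dist_eq_norm, hrem, hrem, Real.dist_eq, Real.coe_toNNReal _ (by positivity)]
  have e : (Complex.I * u * b - ∫ x, (D x : ℂ) * levyKernel u x)
      - (Complex.I * v * b - ∫ x, (D x : ℂ) * levyKernel v x)
      = Complex.I * ((u - v : ℝ) : ℂ) * b
        - ∫ x, (D x : ℂ) * (levyKernel u x - levyKernel v x) := by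
    simp_rw [mul_sub]
    rw [integral_sub (hDk u) (hDk v)]
    push_cast
    ring
  rw [e]
  refine (norm_sub_le _ _).trans ?_
  have hn : ‖∫ x, (D x : ℂ) * (levyKernel u x - levyKernel v x)‖
      ≤ ∫ x, 2 * |u - v| * (D x * |x|) := by
    refine norm_integral_le_of_norm_le (hDint.const_mul _) (ae_of_all _ fun x => ?_)
    rw [norm_mul, Complex.norm_real, Real.norm_of_nonneg (hDnn x)]
    nlinarith [mul_le_mul_of_nonneg_left (norm_levyKernel_sub_le u v x) (hDnn x)]
  rw [integral_const_mul] at hn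
  rw [norm_mul, norm_mul, Complex.norm_I, one_mul, Complex.norm_real, Complex.norm_real,
    Real.norm_eq_abs, Real.norm_eq_abs]
  linarith

theorem levyKhintchineExponent_cgmy_re (hC : 0 < C) (hG : 0 ≤ G) (hM : 0 ≤ M)
    (h1 : 1 < Y) (h2 : Y < 2) (b u : ℝ) :
    (levyKhintchineExponent b 0 (cgmyLevyMeasure C G M Y) u).re
      = ∫ x, cgmyDensity C G M Y x * (Real.cos (u * x) - 1) := by
  have hint := integrable_cgmyDensity_mul_levyKernel hC hG hM h1 h2 u
  rw [levyKhintchineExponent_cgmy hC, Complex.add_re, ← RCLike.re_to_complex (x := ∫ x, _),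
    ← integral_re hint]
  simp [levyKernel_re]

theorem levyKhintchineExponent_cgmy_re_nonpos (hC : 0 < C) (hG : 0 ≤ G) (hM : 0 ≤ M)
    (h1 : 1 < Y) (h2 : Y < 2) (b u : ℝ) :
    (levyKhintchineExponent b 0 (cgmyLevyMeasure C G M Y) u).re ≤ 0 := by
  rw [levyKhintchineExponent_cgmy_re hC hG hM h1 h2]
  exact integral_nonpos fun x => mul_nonpos_of_nonneg_of_nonpos (cgmyDensity_nonneg hC x)
    (by linarith [Real.cos_le_one (u * x)])

/-- Tempering lowers the density while `cos - 1 ≤ 0`, so the real part can only increase from its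
stable value. This supplies the domination in the scaling limit. -/
theorem neg_rpow_le_levyKhintchineExponent_cgmy_re (hC : 0 < C) (hG : 0 ≤ G) (hM : 0 ≤ M)
    (h1 : 1 < Y) (h2 : Y < 2) (b u : ℝ) :
    -(2 * C * Real.Gamma (-Y) * |Real.cos (Real.pi * Y / 2)| * |u| ^ Y)
      ≤ (levyKhintchineExponent b 0 (cgmyLevyMeasure C G M Y) u).re := by
  have hs := integrable_stableDensity_mul_levyKernel hC (by linarith : 0 < Y) h2 u
  have hc := integrable_cgmyDensity_mul_levyKernel hC hG hM h1 h2 u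
  have h := congrArg Complex.re (integral_stableDensity_mul_levyKernel hC h1 h2 u)
  rw [Complex.ofReal_re] at h
  rw [← h, levyKhintchineExponent_cgmy_re hC hG hM h1 h2, ← RCLike.re_to_complex,
    ← integral_re hs]
  refine integral_mono hs.re (by simpa [levyKernel_re] using hc.re) fun x => ?_
  simp only [RCLike.re_to_complex, Complex.re_ofReal_mul, levyKernel_re]
  exact mul_le_mul_of_nonpos_right (cgmyDensity_le_stableDensity hC hG hM (by linarith) x)
    (by linarith [Real.cos_le_one (u * x)])

end

/-! ### One-dimensional marginals of a Lévy process -/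

namespace IsLevyProcess

variable {Ω : Type*} [MeasurableSpace Ω] {P : Measure Ω} [IsProbabilityMeasure P]
  {X : ℝ≥0 → Ω → ℝ}

theorem charFun_map_add (hX : IsLevyProcess X P) (s h : ℝ≥0) (u : ℝ) :
    charFun (P.map (X (s + h))) u = charFun (P.map (X s)) u * charFun (P.map (X h)) u := by
  have hle : s ≤ s + h := le_add_of_nonneg_right zero_le
  have hind := hX.indep_increments.indepFun_eval_sub zero_le hle hX.initial
  have hmap : P.map (X (s + h) - X s) = P.map (X h) := by
    refine (hX.stationary_increments s h).map_eq.trans (Measure.map_congr ?_)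
    filter_upwards [hX.initial] with ω hω
    simp [hω]
  have h1 := hind.charFun_map_add_eq_mul (hX.measurable s).aemeasurable
    ((hX.measurable (s + h)).sub (hX.measurable s)).aemeasurable
  rw [add_sub_cancel, hmap] at h1
  rw [h1, Pi.mul_apply]

theorem charFun_map_nsmul (hX : IsLevyProcess X P) (n : ℕ) (s : ℝ≥0) (u : ℝ) :
    charFun (P.map (X (n * s))) u = charFun (P.map (X s)) u ^ n := by
  induction n with
  | zero =>
    have h0 : P.map (X 0) = Measure.dirac 0 := by
      rw [Measure.map_congr (g := fun _ => (0 : ℝ)) hX.initial, Measure.map_const]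
      simp
    simp [h0]
  | succ n ih => rw [Nat.cast_succ, add_one_mul, hX.charFun_map_add, ih, pow_succ]

/-- Right-continuity of paths and bounded convergence; hence only approach from the right is
allowed. -/
theorem tendsto_charFun_map (hX : IsLevyProcess X P) {s : ℕ → ℝ≥0} {t : ℝ≥0}
    (hs : Tendsto s atTop (𝓝[≥] t)) (u : ℝ) :
    Tendsto (fun n => charFun (P.map (X (s n))) u) atTop (𝓝 (charFun (P.map (X t)) u)) := by
  have h : ∀ t, charFun (P.map (X t)) u = ∫ ω, Complex.exp (u * X t ω * Complex.I) ∂P := by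
    intro t
    rw [charFun_apply_real, integral_map (hX.measurable t).aemeasurable
      (Measurable.aestronglyMeasurable (by fun_prop))]
  simp_rw [h]
  have hm := hX.measurable
  refine tendsto_integral_of_dominated_convergence (fun _ => 1)
    (fun n => Measurable.aestronglyMeasurable (by fun_prop)) (integrable_const _)
    (fun n => ae_of_all _ fun ω => ?_) ?_
  · rw [Complex.norm_exp]; simp
  · filter_upwards [hX.cadlag] with ω hω
    have hc := ((hω t).1.tendsto.comp hs)
    have hcont : Continuous fun x : ℝ => Complex.exp (u * x * Complex.I) := by fun_prop
    exact (hcont.tendsto _).comp hc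

/-- If the law of `X₁` has characteristic function `e^ψ` with `ψ` continuous and `ψ(0) = 0`, then
the law of `X_t` has characteristic function `e^{tψ}`. -/
theorem charFun_map_eq_exp (hX : IsLevyProcess X P) {ψ : ℝ → ℂ} (hψ : Continuous ψ)
    (hψ0 : ψ 0 = 0) (h1 : ∀ u, charFun (P.map (X 1)) u = Complex.exp (ψ u)) (t : ℝ≥0) (u : ℝ) :
    charFun (P.map (X t)) u = Complex.exp (t * ψ u) := by
  have hprob : ∀ t, IsProbabilityMeasure (P.map (X t)) := fun t =>
    Measure.isProbabilityMeasure_map (hX.measurable t).aemeasurable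
  have hdyadic : ∀ n : ℕ, ∀ u, charFun (P.map (X ((2 ^ n)⁻¹))) u
      = Complex.exp ((2 ^ n)⁻¹ * ψ u) := by
    intro n
    induction n with
    | zero => simpa using h1
    | succ n ih =>
      have hEq : EqOn (charFun (P.map (X ((2 ^ (n + 1))⁻¹))))
          (fun u => Complex.exp ((2 ^ (n + 1))⁻¹ * ψ u)) univ := by
        -- Both sides are continuous square roots of the same function, one of them never zero, and
        -- they agree at `u = 0`; on the connected line the sign cannot switch.
        refine isPreconnected_univ.eq_of_sq_eq continuous_charFun.continuousOn
          (by fun_prop) (fun u _ => ?_) (fun _ => Complex.exp_ne_zero _) (mem_univ 0) ?_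
        · have hn := hX.charFun_map_nsmul 2 ((2 ^ (n + 1))⁻¹) u
          have he : ((2 : ℕ) : ℝ≥0) * (2 ^ (n + 1))⁻¹ = (2 ^ n)⁻¹ := by
            rw [pow_succ]; push_cast; field_simp
          rw [he, ih] at hn
          simp only [Pi.pow_apply]
          rw [← hn, ← Complex.exp_nat_mul]
          congr 1
          rw [pow_succ]; push_cast; field_simp
        · simp [hψ0]
      exact fun u => hEq (mem_univ u)
  -- Dyadic times approaching `t`; the `+ 1` after the floor keeps them on its right.
  set s : ℕ → ℝ≥0 := fun n => ((⌊t * 2 ^ n⌋₊ + 1 : ℕ) : ℝ≥0) * (2 ^ n)⁻¹ with hs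
  have hp : ∀ n : ℕ, (0 : ℝ≥0) < 2 ^ n := fun n => by positivity
  have hlow : ∀ n, t ≤ s n := by
    intro n
    simp only [hs]
    rw [← div_eq_mul_inv, le_div_iff₀ (hp n)]
    push_cast
    exact (Nat.lt_floor_add_one _).le
  have hup : ∀ n, s n ≤ t + (2 ^ n)⁻¹ := by
    intro n
    have := Nat.floor_le (zero_le (a := t * 2 ^ n))
    simp only [hs]
    rw [← div_eq_mul_inv, div_le_iff₀ (hp n), add_mul, inv_mul_cancel₀ (hp n).ne']
    push_cast
    gcongr
  have hlim0 : Tendsto (fun n : ℕ => t + ((2 : ℝ≥0) ^ n)⁻¹) atTop (𝓝 t) := by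
    have : Tendsto (fun n : ℕ => ((2 : ℝ≥0)⁻¹) ^ n) atTop (𝓝 0) :=
      tendsto_pow_atTop_nhds_zero_of_lt_one zero_le
        (inv_lt_one_of_one_lt₀ one_lt_two)
    simpa [inv_pow] using this.const_add t
  have hst : Tendsto s atTop (𝓝 t) :=
    tendsto_of_tendsto_of_tendsto_of_le_of_le tendsto_const_nhds hlim0 hlow hup
  have hst' : Tendsto s atTop (𝓝[≥] t) :=
    tendsto_nhdsWithin_iff.2 ⟨hst, Eventually.of_forall hlow⟩
  have hval : ∀ n, charFun (P.map (X (s n))) u = Complex.exp (s n * ψ u) := by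
    intro n
    rw [hs, hX.charFun_map_nsmul, hdyadic, ← Complex.exp_nat_mul]
    push_cast
    rw [mul_assoc]
  refine tendsto_nhds_unique (hX.tendsto_charFun_map hst' u) ?_
  simp_rw [hval]
  have hcont : Continuous fun r : ℝ≥0 => Complex.exp (((r : ℝ) : ℂ) * ψ u) := by fun_prop
  exact (hcont.tendsto t).comp hst

end IsLevyProcess

/-! ### Fourier representation of the call payoff and its error term -/

section CharFun
variable {μ : Measure ℝ} [IsProbabilityMeasure μ]

theorem integrable_of_measurable_of_bound {f : ℝ → ℝ} (hf : Measurable f) {B : ℝ}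
    (hB : ∀ x, |f x| ≤ B) : Integrable f μ :=
  Integrable.of_bound hf.aestronglyMeasurable B (ae_of_all _ hB)

theorem integrable_exp_mul_I (u : ℝ) : Integrable (fun x : ℝ => Complex.exp (u * x * Complex.I)) μ := by
  refine Integrable.of_bound (Measurable.aestronglyMeasurable (by fun_prop)) 1
    (ae_of_all _ fun x => ?_)
  rw [Complex.norm_exp]; simp

theorem charFun_re (u : ℝ) : (charFun μ u).re = ∫ x, Real.cos (u * x) ∂μ := by
  rw [charFun_apply_real, ← RCLike.re_to_complex, ← integral_re (integrable_exp_mul_I u)]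
  refine integral_congr_ae (ae_of_all _ fun x => ?_)
  simp [Complex.exp_re]

theorem charFun_im (u : ℝ) : (charFun μ u).im = ∫ x, Real.sin (u * x) ∂μ := by
  rw [charFun_apply_real, ← RCLike.im_to_complex, ← integral_im (integrable_exp_mul_I u)]
  refine integral_congr_ae (ae_of_all _ fun x => ?_)
  simp [Complex.exp_im]

theorem one_sub_charFun_re (u : ℝ) : 1 - (charFun μ u).re = ∫ x, (1 - Real.cos (u * x)) ∂μ := by
  rw [charFun_re, integral_sub (integrable_const _)
    (integrable_of_measurable_of_bound (by fun_prop) fun x => Real.abs_cos_le_one _)]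
  simp

/-- Represent `1 - e^{-|x|}` as the Cauchy average of `1 - cos(ux)`, apply Fubini, and fold the
integral onto `u > 0` by evenness. -/
theorem integral_one_sub_exp_neg_abs :
    ∫ x, (1 - Real.exp (-|x|)) ∂μ
      = 2 / Real.pi * ∫ u in Ioi (0 : ℝ), (1 - (charFun μ u).re) * (1 + u ^ 2)⁻¹ := by
  have hpt : ∀ x : ℝ, 1 - Real.exp (-|x|)
      = Real.pi⁻¹ * ∫ u : ℝ, (1 - Real.cos (u * x)) * (1 + u ^ 2)⁻¹ := by
    intro x
    have hc : Integrable fun u : ℝ => Real.cos (u * x) * (1 + u ^ 2)⁻¹ :=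
      integrable_inv_one_add_sq.bdd_mul (c := 1) (Measurable.aestronglyMeasurable (by fun_prop))
        (ae_of_all _ fun u => Real.abs_cos_le_one _)
    simp_rw [sub_mul, one_mul]
    rw [integral_sub integrable_inv_one_add_sq hc, integral_univ_inv_one_add_sq,
      integral_cos_mul_div_one_add_sq, ← mul_one_sub, inv_mul_cancel_left₀ Real.pi_ne_zero]
  have hprod : Integrable (Function.uncurry fun x u : ℝ => (1 - Real.cos (u * x)) * (1 + u ^ 2)⁻¹)
      (μ.prod volume) := by
    have h := (integrable_const (μ := μ) (1 : ℝ)).mul_prod integrable_inv_one_add_sq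
    refine Integrable.mono' (h.const_mul 2)
      (Measurable.aestronglyMeasurable (by unfold Function.uncurry; fun_prop))
      (ae_of_all _ fun z => ?_)
    have h1 := Real.cos_le_one (z.2 * z.1)
    have h2 := Real.neg_one_le_cos (z.2 * z.1)
    have h3 : 0 ≤ (1 + z.2 ^ 2)⁻¹ := by positivity
    simp only [Function.uncurry, one_mul]
    rw [Real.norm_of_nonneg (mul_nonneg (by linarith) h3)]
    exact mul_le_mul_of_nonneg_right (by linarith) h3
  have heven : ∀ u : ℝ, (1 - (charFun μ u).re) * (1 + u ^ 2)⁻¹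
      = (1 - (charFun μ |u|).re) * (1 + |u| ^ 2)⁻¹ := by
    intro u
    rcases abs_choice u with h | h
    · rw [h]
    · rw [h, charFun_neg, Complex.conj_re, neg_sq]
  simp_rw [hpt]
  rw [integral_const_mul, integral_integral_swap hprod]
  simp_rw [integral_mul_const, ← one_sub_charFun_re]
  rw [integral_congr_ae (ae_of_all _ heven),
    integral_comp_abs (f := fun u : ℝ => (1 - (charFun μ u).re) * (1 + u ^ 2)⁻¹)]
  ring

/-- The excess of the call payoff at the money over `(e^x - 1 + 1 - e^{-|x|}) / 2`. -/
noncomputable def callExcess (x : ℝ) : ℝ := if 0 < x then Real.cosh x - 1 else 0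

theorem measurable_callExcess : Measurable callExcess :=
  Measurable.ite measurableSet_Ioi (by fun_prop) measurable_const

theorem max_exp_sub_one_eq (x : ℝ) : max (Real.exp x - 1) 0
    = (Real.exp x - 1) / 2 + (1 - Real.exp (-|x|)) / 2 + callExcess x := by
  rw [callExcess]
  split_ifs with h
  · rw [max_eq_left (by linarith [Real.add_one_le_exp x]), abs_of_pos h, Real.cosh_eq]
    ring
  · have hx := not_lt.1 h
    rw [max_eq_right (by linarith [Real.exp_le_one_iff.2 hx]), abs_of_nonpos hx, neg_neg]
    ring

theorem callExcess_nonneg (x : ℝ) : 0 ≤ callExcess x := by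
  rw [callExcess]
  split_ifs
  · linarith [Real.one_le_cosh x]
  · exact le_rfl

/-- The majorant has mean controlled by the characteristic function: `e^x - 1` has mean zero in the
application, `sin` and `cos` come from its value at `1`, and the indicator is a tail probability.
For `x > 0` use `cosh x - 1 = e^x - 1 - sinh x` and `sin x ≤ x ≤ sinh x`. -/
theorem callExcess_le (x : ℝ) : callExcess x ≤ Real.exp x - 1 - Real.sin x
    + 2 * {x : ℝ | 1 < |x|}.indicator 1 x + 2 * (1 - Real.cos x) := by
  have hc : 0 ≤ 1 - Real.cos x := by linarith [Real.cos_le_one x]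
  have hind : 0 ≤ {x : ℝ | 1 < |x|}.indicator (1 : ℝ → ℝ) x :=
    indicator_nonneg (fun _ _ => zero_le_one) x
  rw [callExcess]
  split_ifs with h
  · have h1 : Real.sin x ≤ x := Real.sin_le h.le
    have h2 : x ≤ Real.sinh x := Real.self_le_sinh_iff.2 h.le
    have h3 := Real.cosh_add_sinh x
    linarith
  · rcases le_or_gt |x| 1 with h1 | h1
    · have hx := not_lt.1 h
      have h2 := Real.add_one_le_exp x
      -- Thus `2 * (1 - cos x) ≥ 0.4 x²`, which absorbs the cubic error in `x - sin x` on `[-1, 0]`.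
      have hpi : (0.2 : ℝ) ≤ 2 / Real.pi ^ 2 := by
        rw [le_div_iff₀ (by positivity)]
        nlinarith [Real.pi_lt_d2, Real.pi_pos]
      have hcos := Real.cos_le_one_sub_mul_cos_sq (x := x) (by linarith [Real.pi_gt_three])
      have hsin := Real.sin_ge_sub_cube (x := -x) (by linarith)
      rw [abs_of_nonpos hx] at h1
      rw [Real.sin_neg] at hsin
      nlinarith [mul_le_mul_of_nonneg_right hpi (sq_nonneg x),
        mul_nonneg (sq_nonneg x) (by linarith : 0 ≤ 1 + x)]
    · rw [indicator_of_mem (show x ∈ {x : ℝ | 1 < |x|} from h1), Pi.one_apply]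
      linarith [Real.sin_le_one x, Real.exp_pos x]

omit [IsProbabilityMeasure μ] in
theorem integrable_callExcess (hint : Integrable Real.exp μ) : Integrable callExcess μ := by
  refine hint.mono' measurable_callExcess.aestronglyMeasurable (ae_of_all _ fun x => ?_)
  rw [Real.norm_of_nonneg (callExcess_nonneg x), callExcess]
  split_ifs with h
  · linarith [Real.cosh_add_sinh x, Real.sinh_pos_iff.2 h]
  · exact (Real.exp_pos x).le

theorem integral_callExcess_le (hint : Integrable Real.exp μ) (hone : ∫ x, Real.exp x ∂μ = 1) :
    ∫ x, callExcess x ∂μ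
      ≤ 3 * ‖1 - charFun μ 1‖ + ‖∫ u in (-2 : ℝ)..2, 1 - charFun μ u‖ := by
  have hsin : Integrable (fun x => Real.sin x) μ :=
    integrable_of_measurable_of_bound (by fun_prop) fun x => Real.abs_sin_le_one _
  have hcos : Integrable (fun x => 1 - Real.cos x) μ :=
    (integrable_const _).sub
      (integrable_of_measurable_of_bound (by fun_prop) fun x => Real.abs_cos_le_one _)
  have hms : MeasurableSet {x : ℝ | 1 < |x|} := measurableSet_lt (by fun_prop) (by fun_prop)
  have hind : Integrable ({x : ℝ | 1 < |x|}.indicator (1 : ℝ → ℝ)) μ :=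
    (integrable_const (1 : ℝ)).indicator hms
  have hA : Integrable (fun x => Real.exp x - 1) μ := hint.sub (integrable_const 1)
  have hB : Integrable (fun x => Real.exp x - 1 - Real.sin x) μ := hA.sub hsin
  have hD : Integrable (fun x => Real.exp x - 1 - Real.sin x
      + 2 * {x : ℝ | 1 < |x|}.indicator (1 : ℝ → ℝ) x) μ := hB.add (hind.const_mul 2)
  have h1 := integral_mono (integrable_callExcess hint) (hD.add (hcos.const_mul 2)) callExcess_le
  have h2 : ∫ x, (Real.exp x - 1 - Real.sin x
      + 2 * {x : ℝ | 1 < |x|}.indicator 1 x + 2 * (1 - Real.cos x)) ∂μ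
      = -(charFun μ 1).im + 2 * μ.real {x : ℝ | 1 < |x|} + 2 * (1 - (charFun μ 1).re) := by
    rw [integral_add hD (hcos.const_mul 2), integral_add hB (hind.const_mul 2),
      integral_sub hA hsin,
      integral_sub hint (integrable_const 1), hone, integral_const_mul, integral_const_mul,
      integral_indicator_one hms, one_sub_charFun_re, charFun_im]
    simp
  -- The tail bound at radius `1` is the source of the interval `[-2, 2]`.
  have h3 := measureReal_abs_gt_le_integral_charFun (μ := μ) one_pos
  have h4 : -(charFun μ 1).im ≤ ‖1 - charFun μ 1‖ := by
    have := (le_abs_self _).trans (Complex.abs_im_le_norm (1 - charFun μ 1))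
    simpa using this
  have h5 : 1 - (charFun μ 1).re ≤ ‖1 - charFun μ 1‖ := by
    have := (le_abs_self _).trans (Complex.abs_re_le_norm (1 - charFun μ 1))
    simpa using this
  refine (h1.trans_eq h2).trans ?_
  norm_num at h3
  linarith

theorem abs_integral_max_exp_sub_one_sub_le (hint : Integrable Real.exp μ)
    (hone : ∫ x, Real.exp x ∂μ = 1) :
    |∫ x, max (Real.exp x - 1) 0 ∂μ
        - 1 / Real.pi * ∫ u in Ioi (0 : ℝ), (1 - (charFun μ u).re) * (1 + u ^ 2)⁻¹|
      ≤ 3 * ‖1 - charFun μ 1‖ + ‖∫ u in (-2 : ℝ)..2, 1 - charFun μ u‖ := by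
  have habs : Integrable (fun x => 1 - Real.exp (-|x|)) μ := by
    refine integrable_of_measurable_of_bound (by fun_prop) (B := 1) fun x => ?_
    have h1 := Real.exp_pos (-|x|)
    have h2 : Real.exp (-|x|) ≤ 1 := Real.exp_le_one_iff.2 (by simp)
    rw [abs_of_nonneg] <;> linarith
  have hexp : Integrable (fun x => Real.exp x - 1) μ := hint.sub (integrable_const 1)
  have h : ∫ x, max (Real.exp x - 1) 0 ∂μ
      = 1 / Real.pi * (∫ u in Ioi (0 : ℝ), (1 - (charFun μ u).re) * (1 + u ^ 2)⁻¹)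
        + ∫ x, callExcess x ∂μ := by
    have hsum : Integrable (fun x => (Real.exp x - 1) / 2 + (1 - Real.exp (-|x|)) / 2) μ :=
      (hexp.div_const 2).add (habs.div_const 2)
    simp_rw [max_exp_sub_one_eq]
    rw [integral_add hsum (integrable_callExcess hint),
      integral_add (hexp.div_const 2) (habs.div_const 2), integral_div, integral_div,
      integral_sub hint (integrable_const 1), hone, integral_one_sub_exp_neg_abs]
    simp
    ring
  rw [h, add_sub_cancel_left, abs_of_nonneg (integral_nonneg callExcess_nonneg)]
  exact integral_callExcess_le hint hone

end CharFun

/-! ### The scaling limit -/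

/-- Taking the real part makes the bound quadratic in `z.im`. This is essential: after scaling
`z.im` is only `O(v)`, and a linear term divided by `v²` would not be integrable at `0`. -/
theorem abs_one_sub_exp_re_le {z : ℂ} (hz : z.re ≤ 0) :
    |1 - (Complex.exp z).re| ≤ -z.re + z.im ^ 2 / 2 := by
  rw [Complex.exp_re]
  have h1 := Real.add_one_le_exp z.re
  have h2 : Real.exp z.re ≤ 1 := Real.exp_le_one_iff.2 hz
  have h3 := Real.one_sub_sq_div_two_le_cos (x := z.im)
  have h4 := Real.cos_le_one z.im
  have h5 := Real.exp_pos z.re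
  rw [abs_of_nonneg (by nlinarith)]
  nlinarith

theorem abs_one_sub_exp_re_le_two {z : ℂ} (hz : z.re ≤ 0) :
    |1 - (Complex.exp z).re| ≤ 2 := by
  have h1 : ‖Complex.exp z‖ ≤ 1 := by rw [Complex.norm_exp]; exact Real.exp_le_one_iff.2 hz
  have h2 := abs_le.1 ((Complex.abs_re_le_norm (Complex.exp z)).trans h1)
  rw [abs_le]
  constructor <;> linarith [h2.1, h2.2]

theorem norm_one_sub_exp_le {z : ℂ} (hz : z.re ≤ 0) : ‖1 - Complex.exp z‖ ≤ 2 * ‖z‖ := by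
  rcases le_or_gt ‖z‖ 1 with h | h
  · rw [norm_sub_rev]
    exact Complex.norm_exp_sub_one_le h
  · have h1 : ‖Complex.exp z‖ ≤ 1 := by rw [Complex.norm_exp]; exact Real.exp_le_one_iff.2 hz
    have h2 := norm_sub_le 1 (Complex.exp z)
    rw [norm_one] at h2
    linarith

section Asymptotics
variable {ψ : ℝ → ℂ} {a Y K : ℝ}

/-- The power is homogeneous under this scaling, and the linear error becomes `ε^(Y-1) K v`, which
tends to `0`. -/
theorem tendsto_scaled_exponent (hY : 1 < Y)
    (hK : ∀ u, ‖ψ u + ((a * |u| ^ Y : ℝ) : ℂ)‖ ≤ K * |u|) {v : ℝ} (hv : 0 < v) :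
    Tendsto (fun ε : ℝ => ((ε ^ Y : ℝ) : ℂ) * ψ (ε⁻¹ * v)) (𝓝[>] 0)
      (𝓝 ((-a * v ^ Y : ℝ) : ℂ)) := by
  rw [tendsto_iff_norm_sub_tendsto_zero]
  have hz : Tendsto (fun ε : ℝ => ε ^ (Y - 1) * (K * v)) (𝓝[>] 0) (𝓝 0) := by
    have : ContinuousAt (fun ε : ℝ => ε ^ (Y - 1) * (K * v)) 0 :=
      (Real.continuousAt_rpow_const _ _ (Or.inr (by linarith))).mul_const _
    have h2 := this.tendsto.mono_left (nhdsWithin_le_nhds (s := Ioi 0))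
    simpa [Real.zero_rpow (by linarith : Y - 1 ≠ 0)] using h2
  refine squeeze_zero' (Eventually.of_forall fun _ => norm_nonneg _) ?_ hz
  filter_upwards [self_mem_nhdsWithin] with ε hε
  have hε0 : (0 : ℝ) < ε := hε
  have hεY : 0 < ε ^ Y := Real.rpow_pos_of_pos hε0 _
  have h := hK (ε⁻¹ * v)
  rw [abs_of_pos (by positivity), Real.mul_rpow (by positivity) hv.le, Real.inv_rpow hε0.le] at h
  have e : ((ε ^ Y : ℝ) : ℂ) * ψ (ε⁻¹ * v) - ((-a * v ^ Y : ℝ) : ℂ)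
      = ((ε ^ Y : ℝ) : ℂ) * (ψ (ε⁻¹ * v) + ((a * ((ε ^ Y)⁻¹ * v ^ Y) : ℝ) : ℂ)) := by
    have : a * v ^ Y = ε ^ Y * (a * ((ε ^ Y)⁻¹ * v ^ Y)) := by field_simp
    rw [neg_mul, this]
    push_cast
    ring
  rw [e, norm_mul, Complex.norm_real, Real.norm_of_nonneg hεY.le, Real.rpow_sub_one hε0.ne']
  calc ε ^ Y * _ ≤ ε ^ Y * (K * (ε⁻¹ * v)) := by gcongr
    _ = _ := by ring

theorem scaled_re_nonpos (hre : ∀ u, (ψ u).re ≤ 0) {s : ℝ} (hs : 0 ≤ s) (u : ℝ) :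
    ((s : ℂ) * ψ u).re ≤ 0 := by
  rw [Complex.re_ofReal_mul]
  exact mul_nonpos_of_nonneg_of_nonpos hs (hre u)

theorem abs_one_sub_exp_scaled_le (hY : 1 < Y)
    (hK : ∀ u, ‖ψ u + ((a * |u| ^ Y : ℝ) : ℂ)‖ ≤ K * |u|)
    (hre : ∀ u, (ψ u).re ≤ 0) (hre' : ∀ u, -(a * |u| ^ Y) ≤ (ψ u).re)
    {ε v : ℝ} (hε : 0 < ε) (hε1 : ε ≤ 1) (hv : 0 < v) :
    |1 - (Complex.exp (((ε ^ Y : ℝ) : ℂ) * ψ (ε⁻¹ * v))).re| ≤ a * v ^ Y + K ^ 2 * v ^ 2 / 2 := by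
  have hεY : 0 < ε ^ Y := Real.rpow_pos_of_pos hε _
  refine (abs_one_sub_exp_re_le (scaled_re_nonpos hre hεY.le _)).trans ?_
  rw [Complex.re_ofReal_mul, Complex.im_ofReal_mul]
  have h1 := hre' (ε⁻¹ * v)
  have h2 := (Complex.abs_im_le_norm _).trans (hK (ε⁻¹ * v))
  -- The added power is real, so the linear error bound controls the imaginary part of `ψ` itself.
  rw [Complex.add_im, Complex.ofReal_im, add_zero] at h2
  rw [abs_of_pos (by positivity : 0 < ε⁻¹ * v)] at h1 h2
  rw [Real.mul_rpow (by positivity) hv.le, Real.inv_rpow hε.le] at h1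
  have h3 : -(ε ^ Y * (ψ (ε⁻¹ * v)).re) ≤ a * v ^ Y := by
    have := mul_le_mul_of_nonneg_left h1 hεY.le
    have e : ε ^ Y * -(a * ((ε ^ Y)⁻¹ * v ^ Y)) = -(a * v ^ Y) := by field_simp
    linarith
  have h4 : |ε ^ Y * (ψ (ε⁻¹ * v)).im| ≤ K * v := by
    rw [abs_mul, abs_of_pos hεY]
    have h5 : ε ^ Y ≤ ε := by
      simpa using Real.rpow_le_rpow_of_exponent_ge hε hε1 hY.le
    calc ε ^ Y * |(ψ (ε⁻¹ * v)).im| ≤ ε * (K * (ε⁻¹ * v)) := by gcongr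
      _ = K * v := by field_simp
  have h6 : (ε ^ Y * (ψ (ε⁻¹ * v)).im) ^ 2 ≤ (K * v) ^ 2 := sq_le_sq' (abs_le.1 h4).1 (abs_le.1 h4).2
  nlinarith

/-- If `ψ(u) = -a |u|^Y + O(|u|)`, the rescaled Fourier integral converges to the stable one. -/
theorem tendsto_integral_scaled (hψ : Continuous ψ) (ha : 0 < a) (hY : 1 < Y)
    (hK : ∀ u, ‖ψ u + ((a * |u| ^ Y : ℝ) : ℂ)‖ ≤ K * |u|)
    (hre : ∀ u, (ψ u).re ≤ 0) (hre' : ∀ u, -(a * |u| ^ Y) ≤ (ψ u).re) :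
    Tendsto (fun ε : ℝ => ∫ v in Ioi (0 : ℝ),
        (1 - (Complex.exp (((ε ^ Y : ℝ) : ℂ) * ψ (ε⁻¹ * v))).re) / (ε ^ 2 + v ^ 2)) (𝓝[>] 0)
      (𝓝 (∫ v in Ioi (0 : ℝ), (1 - Real.exp (-a * v ^ Y)) / v ^ 2)) := by
  -- The majorant uses the quadratic estimate on `(0, 1]` and the trivial bound `2` beyond; neither
  -- depends on `ε`.
  have hbound : IntegrableOn
      (fun v : ℝ => if v ≤ 1 then a * v ^ (Y - 2) + K ^ 2 / 2 else 2 * v ^ (-2 : ℝ)) (Ioi 0) := by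
    rw [← Ioc_union_Ioi_eq_Ioi (zero_le_one' ℝ)]
    refine IntegrableOn.union ?_ ?_
    · refine IntegrableOn.congr_fun (f := fun v : ℝ => a * v ^ (Y - 2) + K ^ 2 / 2) ?_
        (fun v hv => (if_pos hv.2).symm) measurableSet_Ioc
      exact (((intervalIntegrable_iff_integrableOn_Ioc_of_le zero_le_one).1
        (intervalIntegral.intervalIntegrable_rpow' (by linarith))).const_mul a).add
        (integrableOn_const (by simp))
    · refine IntegrableOn.congr_fun (f := fun v : ℝ => 2 * v ^ (-2 : ℝ)) ?_
        (fun v hv => (if_neg (not_le.2 hv)).symm) measurableSet_Ioi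
      exact (integrableOn_Ioi_rpow_of_lt (by norm_num) zero_lt_one).const_mul 2
  have hsmall : ∀ᶠ ε : ℝ in 𝓝[>] 0, ε ∈ Ioc (0 : ℝ) 1 := Ioc_mem_nhdsGT zero_lt_one
  refine tendsto_integral_filter_of_dominated_convergence _ ?_ ?_ hbound ?_
  · filter_upwards [hsmall] with ε hε
    refine Measurable.aestronglyMeasurable (Measurable.div ?_ (by fun_prop))
    exact (Continuous.sub continuous_const (Complex.continuous_re.comp (by fun_prop))).measurable
  · filter_upwards [hsmall] with ε hε
    refine (ae_restrict_iff' measurableSet_Ioi).2 (ae_of_all _ fun v hv => ?_)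
    have hv0 : (0 : ℝ) < v := hv
    have hε2 : 0 ≤ ε ^ 2 := sq_nonneg ε
    rw [norm_div, Real.norm_of_nonneg (by positivity : 0 ≤ ε ^ 2 + v ^ 2), Real.norm_eq_abs]
    split_ifs with h
    · have h1 := abs_one_sub_exp_scaled_le hY hK hre hre' hε.1 hε.2 hv0
      have e : a * v ^ (Y - 2) + K ^ 2 / 2 = (a * v ^ Y + K ^ 2 * v ^ 2 / 2) / v ^ 2 := by
        rw [Real.rpow_sub hv0, Real.rpow_two]
        field_simp
      have hnn : 0 ≤ a * v ^ Y + K ^ 2 * v ^ 2 / 2 := (abs_nonneg _).trans h1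
      rw [e]
      gcongr
      linarith
    · rw [Real.rpow_neg hv0.le, Real.rpow_two, ← div_eq_mul_inv]
      gcongr
      · exact abs_one_sub_exp_re_le_two
          (scaled_re_nonpos hre (Real.rpow_nonneg hε.1.le _) _)
      · linarith
  · refine (ae_restrict_iff' measurableSet_Ioi).2 (ae_of_all _ fun v hv => ?_)
    have hv0 : (0 : ℝ) < v := hv
    have h1 := tendsto_scaled_exponent hY hK hv0
    have hc : Continuous fun z : ℂ => 1 - (Complex.exp z).re :=
      continuous_const.sub (Complex.continuous_re.comp Complex.continuous_exp)
    have h2 := (hc.tendsto _).comp h1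
    have h3 : Tendsto (fun ε : ℝ => ε ^ 2 + v ^ 2) (𝓝[>] 0) (𝓝 (v ^ 2)) := by
      have : ContinuousAt (fun ε : ℝ => ε ^ 2 + v ^ 2) 0 := by fun_prop
      simpa using this.tendsto.mono_left (nhdsWithin_le_nhds (s := Ioi 0))
    have h4 := h2.div h3 (by positivity)
    rw [← Complex.ofReal_exp, Complex.ofReal_re] at h4
    exact h4

theorem integral_one_sub_exp_re_mul_inv_one_add_sq {ε : ℝ} (hε : 0 < ε) (s : ℂ) :
    ∫ u in Ioi (0 : ℝ), (1 - (Complex.exp (s * ψ u)).re) * (1 + u ^ 2)⁻¹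
      = ε * ∫ v in Ioi (0 : ℝ), (1 - (Complex.exp (s * ψ (ε⁻¹ * v))).re) / (ε ^ 2 + v ^ 2) := by
  have h := integral_comp_mul_left_Ioi
    (fun u : ℝ => (1 - (Complex.exp (s * ψ u)).re) * (1 + u ^ 2)⁻¹) 0 (inv_pos.2 hε)
  rw [mul_zero, inv_inv, smul_eq_mul] at h
  have h2 : ∀ v : ℝ, (1 - (Complex.exp (s * ψ (ε⁻¹ * v))).re) * (1 + (ε⁻¹ * v) ^ 2)⁻¹
      = ε ^ 2 * ((1 - (Complex.exp (s * ψ (ε⁻¹ * v))).re) / (ε ^ 2 + v ^ 2)) := by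
    intro v
    field_simp
  simp_rw [h2] at h
  rw [integral_const_mul] at h
  have h3 : ε * (∫ u in Ioi (0 : ℝ), (1 - (Complex.exp (s * ψ u)).re) * (1 + u ^ 2)⁻¹)
    = ε * (ε * ∫ v in Ioi (0 : ℝ), (1 - (Complex.exp (s * ψ (ε⁻¹ * v))).re) / (ε ^ 2 + v ^ 2)) := by
    rw [← h]; ring
  exact mul_left_cancel₀ hε.ne' h3

/-- Small-time asymptotics of `∫ (e^x - 1)₊ dμ_t` for laws `μ_t` with characteristic functions
`e^{tψ}`, where `ψ(u) = -a |u|^Y + O(|u|)`. -/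
theorem isLittleO_integral_max_exp_sub_one {μ : ℝ≥0 → Measure ℝ} (hμ : ∀ t, IsProbabilityMeasure (μ t))
    (hchar : ∀ t u, charFun (μ t) u = Complex.exp ((t : ℝ) * ψ u))
    (hint : ∀ t, Integrable Real.exp (μ t)) (hone : ∀ t, ∫ x, Real.exp x ∂(μ t) = 1)
    (hψ : Continuous ψ) (ha : 0 < a) (hY : 1 < Y)
    (hK : ∀ u, ‖ψ u + ((a * |u| ^ Y : ℝ) : ℂ)‖ ≤ K * |u|)
    (hre : ∀ u, (ψ u).re ≤ 0) (hre' : ∀ u, -(a * |u| ^ Y) ≤ (ψ u).re) :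
    (fun t : ℝ≥0 => ∫ x, max (Real.exp x - 1) 0 ∂(μ t)
      - 1 / Real.pi * (∫ v in Ioi (0 : ℝ), (1 - Real.exp (-a * v ^ Y)) / v ^ 2)
        * (t : ℝ) ^ (1 / Y))
      =o[𝓝[>] 0] (fun t : ℝ≥0 => (t : ℝ) ^ (1 / Y)) := by
  set J : ℝ := ∫ v in Ioi (0 : ℝ), (1 - Real.exp (-a * v ^ Y)) / v ^ 2
  set F : ℝ → ℝ := fun ε => ∫ v in Ioi (0 : ℝ),
    (1 - (Complex.exp (((ε ^ Y : ℝ) : ℂ) * ψ (ε⁻¹ * v))).re) / (ε ^ 2 + v ^ 2) with hF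
  have hY0 : 0 < Y := by linarith
  have hpos : ∀ᶠ t : ℝ≥0 in 𝓝[>] 0, 0 < (t : ℝ) := by
    filter_upwards [self_mem_nhdsWithin] with t ht
    exact NNReal.coe_pos.2 ht
  have hcoe : Tendsto (fun t : ℝ≥0 => (t : ℝ)) (𝓝[>] 0) (𝓝[>] 0) :=
    tendsto_nhdsWithin_iff.2
      ⟨(NNReal.continuous_coe.tendsto 0).mono_left nhdsWithin_le_nhds, hpos⟩
  have hrpow : ∀ p : ℝ, 0 < p → Tendsto (fun t : ℝ => t ^ p) (𝓝[>] 0) (𝓝[>] 0) := by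
    intro p hp
    refine tendsto_nhdsWithin_iff.2 ⟨?_, ?_⟩
    · have := (Real.continuousAt_rpow_const 0 p (Or.inr hp.le)).tendsto
      rw [Real.zero_rpow hp.ne'] at this
      exact this.mono_left nhdsWithin_le_nhds
    · filter_upwards [self_mem_nhdsWithin] with t ht
      exact Real.rpow_pos_of_pos ht _
  have hmain : (fun t : ℝ≥0 => 1 / Real.pi * ((F ((t : ℝ) ^ (1 / Y)) - J)) * (t : ℝ) ^ (1 / Y))
      =o[𝓝[>] 0] (fun t : ℝ≥0 => (t : ℝ) ^ (1 / Y)) := by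
    have h1 : Tendsto (fun t : ℝ≥0 => F ((t : ℝ) ^ (1 / Y))) (𝓝[>] 0) (𝓝 J) :=
      ((tendsto_integral_scaled hψ ha hY hK hre hre').comp
        (hrpow (1 / Y) (by positivity))).comp hcoe
    have h2 : Tendsto (fun t : ℝ≥0 => 1 / Real.pi * ((F ((t : ℝ) ^ (1 / Y)) - J))) (𝓝[>] 0) (𝓝 0) := by
      simpa using (h1.sub_const J).const_mul (1 / Real.pi)
    have h3 := ((isLittleO_one_iff ℝ).2 h2).mul_isBigO
      (isBigO_refl (fun t : ℝ≥0 => (t : ℝ) ^ (1 / Y)) (𝓝[>] 0))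
    simpa only [one_mul] using h3
  -- `B` bounds `ψ` on the window needed for the error term, so `1 - charFun` is `O(t)` uniformly
  -- there.
  obtain ⟨B, hB⟩ := (isCompact_Icc (a := (-2 : ℝ)) (b := 2)).exists_bound_of_continuousOn
    hψ.continuousOn
  have hchar_le : ∀ (t : ℝ≥0) (u : ℝ), u ∈ Icc (-2 : ℝ) 2 → ‖1 - charFun (μ t) u‖ ≤ 2 * B * t := by
    intro t u hu
    rw [hchar]
    refine (norm_one_sub_exp_le (scaled_re_nonpos hre t.coe_nonneg u)).trans ?_
    rw [norm_mul, Complex.norm_real, Real.norm_of_nonneg t.coe_nonneg]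
    have := mul_le_mul_of_nonneg_left (hB u hu) t.coe_nonneg
    linarith
  have herr : (fun t : ℝ≥0 => ∫ x, max (Real.exp x - 1) 0 ∂(μ t)
      - 1 / Real.pi * ∫ u in Ioi (0 : ℝ), (1 - (charFun (μ t) u).re) * (1 + u ^ 2)⁻¹)
      =o[𝓝[>] 0] (fun t : ℝ≥0 => (t : ℝ) ^ (1 / Y)) := by
    have h1 : (fun t : ℝ≥0 => ∫ x, max (Real.exp x - 1) 0 ∂(μ t)
        - 1 / Real.pi * ∫ u in Ioi (0 : ℝ), (1 - (charFun (μ t) u).re) * (1 + u ^ 2)⁻¹)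
        =O[𝓝[>] 0] (fun t : ℝ≥0 => (t : ℝ)) := by
      -- `14 = 3 · 2 + 4 · 2`: three times the bound `2Bt` at `u = 1`, plus its integral over an
      -- interval of length `4`.
      refine IsBigO.of_bound (14 * B) (Eventually.of_forall fun t => ?_)
      have := hμ t
      refine (abs_integral_max_exp_sub_one_sub_le (hint t) (hone t)).trans ?_
      have h2 := hchar_le t 1 ⟨by norm_num, by norm_num⟩
      have h3 : ‖∫ u in (-2 : ℝ)..2, 1 - charFun (μ t) u‖ ≤ 2 * B * t * |2 - (-2)| := by
        refine intervalIntegral.norm_integral_le_of_norm_le_const fun u hu => ?_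
        rw [uIoc_of_le (by norm_num)] at hu
        exact hchar_le t u ⟨hu.1.le, hu.2⟩
      rw [Real.norm_of_nonneg t.coe_nonneg]
      norm_num at h3
      linarith
    refine h1.trans_isLittleO ?_
    -- Since `Y > 1`, `t = t^(1-1/Y) t^(1/Y)` is `o(t^(1/Y))`.
    have h2 : Tendsto (fun t : ℝ≥0 => (t : ℝ) ^ (1 - 1 / Y)) (𝓝[>] 0) (𝓝 0) :=
      ((hrpow (1 - 1 / Y) (by rw [sub_pos, div_lt_one hY0]; exact hY)).comp hcoe).mono_right
        nhdsWithin_le_nhds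
    have h3 := ((isLittleO_one_iff ℝ).2 h2).mul_isBigO
      (isBigO_refl (fun t : ℝ≥0 => (t : ℝ) ^ (1 / Y)) (𝓝[>] 0))
    refine h3.congr' ?_ (by simp only [one_mul]; rfl)
    filter_upwards [hpos] with t ht
    rw [← Real.rpow_add ht, sub_add_cancel, Real.rpow_one]
  refine (herr.add hmain).congr' ?_ EventuallyEq.rfl
  filter_upwards [hpos] with t ht
  have hε : 0 < (t : ℝ) ^ (1 / Y) := Real.rpow_pos_of_pos ht _
  have hεY : ((t : ℝ) ^ (1 / Y)) ^ Y = t := by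
    rw [← Real.rpow_mul ht.le, one_div_mul_cancel hY0.ne', Real.rpow_one]
  simp_rw [hchar]
  rw [integral_one_sub_exp_re_mul_inv_one_add_sq hε, hF]
  simp only [hεY]
  ring

end Asymptotics

/-! ### Identification of the constant and conclusion -/

/-- The principal powers are `(±i)^Y = e^{±iπY/2}`, with sum `2 cos(πY/2)`, negative for `1 < Y <
2`. -/
theorem theta0_eq {C Y : ℝ} (h1 : 1 < Y) (h2 : Y < 2) (u : ℝ) :
    theta0 C Y u
      = ((-(2 * C * Real.Gamma (-Y) * |Real.cos (Real.pi * Y / 2)|) * |u| ^ Y : ℝ) : ℂ) := by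
  have hpi := Real.pi_pos
  have hcos : Real.cos (Real.pi * Y / 2) < 0 :=
    Real.cos_neg_of_pi_div_two_lt_of_lt (by nlinarith) (by nlinarith)
  have hI : (-Complex.I) ^ (Y : ℂ) + Complex.I ^ (Y : ℂ)
      = 2 * Complex.cos (Real.pi * Y / 2) := by
    rw [Complex.cpow_def_of_ne_zero (neg_ne_zero.2 Complex.I_ne_zero),
      Complex.cpow_def_of_ne_zero Complex.I_ne_zero, Complex.log_neg_I, Complex.log_I,
      Complex.cos]
    ring_nf
  rw [theta0, hI, abs_of_neg hcos]
  push_cast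
  ring

theorem d1Integrand_eq {C Y : ℝ} (h1 : 1 < Y) (h2 : Y < 2) {u : ℝ} (hu : 0 < u) :
    d1Integrand C Y u = (((1 - Real.exp (-(2 * C * Real.Gamma (-Y)
      * |Real.cos (Real.pi * Y / 2)|) * u ^ Y)) / u ^ 2 : ℝ) : ℂ) := by
  rw [d1Integrand, theta0_eq h1 h2, abs_of_pos hu]
  push_cast
  rfl

theorem stable_scale_pos {C Y : ℝ} (hC : 0 < C) (h1 : 1 < Y) (h2 : Y < 2) :
    0 < 2 * C * Real.Gamma (-Y) * |Real.cos (Real.pi * Y / 2)| := by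
  have hpi := Real.pi_pos
  have hcos : Real.cos (Real.pi * Y / 2) < 0 :=
    Real.cos_neg_of_pi_div_two_lt_of_lt (by nlinarith) (by nlinarith)
  have hG : 0 < Real.Gamma (-Y) := by
    -- Two steps of the functional equation give `Γ(2-Y) = (1-Y)(-Y) Γ(-Y)`, where `Γ(2-Y)` and the
    -- product of the two negative factors are positive.
    have e1 := Real.Gamma_add_one (s := -Y) (by linarith)
    have e2 := Real.Gamma_add_one (s := -Y + 1) (by linarith)
    have e3 : 0 < Real.Gamma (-Y + 1 + 1) := Real.Gamma_pos_of_pos (by linarith)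
    rw [e2, e1] at e3
    have e4 : 0 < (-Y + 1) * -Y := by nlinarith
    rw [← mul_assoc] at e3
    exact pos_of_mul_pos_right e3 e4.le
  have := abs_pos.2 hcos.ne
  positivity

theorem mainTheorem3 {Ω : Type*} [MeasurableSpace Ω] (P : Measure Ω) [IsProbabilityMeasure P]
    (X : ℝ≥0 → Ω → ℝ) (C G M Y b S₀ : ℝ) (hS₀ : 0 < S₀)
    (hX : IsCGMYProcess X P C G M Y b) (hM : 1 < M)
    (hmart : IsMartingaleOwnFiltration (expAsset S₀ X) P) :
    IntegrableOn (d1Integrand C Y) (Ioi 0) volume ∧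
    d1 C Y = 1 / Real.pi * Real.Gamma (1 - 1 / Y)
      * (2 * C * Real.Gamma (-Y) * |Real.cos (Real.pi * Y / 2)|) ^ (1 / Y) ∧
    (fun t : ℝ≥0 => callPrice P S₀ X t 0 - d1 C Y * (t : ℝ) ^ (1 / Y))
      =o[𝓝[>] 0] (fun t : ℝ≥0 => (t : ℝ) ^ (1 / Y)) := by
  obtain ⟨hC, hG, hM0, h1, h2, hL, htrip⟩ := hX
  set a := 2 * C * Real.Gamma (-Y) * |Real.cos (Real.pi * Y / 2)| with ha_def
  have ha : 0 < a := stable_scale_pos hC h1 h2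
  have heq : EqOn (fun u : ℝ => (((1 - Real.exp (-a * u ^ Y)) / u ^ 2 : ℝ) : ℂ))
      (d1Integrand C Y) (Ioi 0) := fun u hu => (d1Integrand_eq h1 h2 hu).symm
  have hd1 : d1 C Y = 1 / Real.pi * ∫ v in Ioi (0 : ℝ), (1 - Real.exp (-a * v ^ Y)) / v ^ 2 := by
    rw [d1, ← setIntegral_congr_fun measurableSet_Ioi heq, integral_complex_ofReal,
      Complex.ofReal_re]
  refine ⟨?_, ?_, ?_⟩
  · have hint : IntegrableOn (fun u : ℝ => (((1 - Real.exp (-a * u ^ Y)) / u ^ 2 : ℝ) : ℂ))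
        (Ioi 0) := Integrable.ofReal (integrableOn_one_sub_exp_neg_mul_rpow_div_sq ha h1)
    exact hint.congr_fun heq measurableSet_Ioi
  · rw [hd1, integral_one_sub_exp_neg_mul_rpow_div_sq ha h1, mul_assoc]
  set ψ := levyKhintchineExponent b 0 (cgmyLevyMeasure C G M Y) with hψ_def
  -- The Lipschitz property yields both the continuity of `ψ` and, as the function vanishes at `0`,
  -- the bound `K|u|`.
  obtain ⟨K, hK⟩ := exists_lipschitz_levyKhintchineExponent_add_rpow hC hG hM0 h1 h2 b
  replace hK : LipschitzWith K fun u : ℝ => ψ u + ((a * |u| ^ Y : ℝ) : ℂ) := hK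
  have hψ0 : ψ 0 = 0 := by simp [hψ_def, levyKhintchineExponent]
  have hψ : Continuous ψ := by
    have hr : Continuous fun u : ℝ => ((a * |u| ^ Y : ℝ) : ℂ) :=
      Complex.continuous_ofReal.comp
        (continuous_const.mul (continuous_abs.rpow_const fun _ => Or.inr (by linarith)))
    exact (hK.continuous.sub hr).congr fun u => add_sub_cancel_right _ _
  have hKb : ∀ u, ‖ψ u + ((a * |u| ^ Y : ℝ) : ℂ)‖ ≤ K * |u| := by
    intro u
    have h := hK.dist_le_mul u 0
    rw [dist_eq_norm, dist_zero_right] at h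
    simpa only [hψ0, abs_zero, Real.zero_rpow (by linarith : Y ≠ 0), mul_zero, Complex.ofReal_zero,
      add_zero, sub_zero, Real.norm_eq_abs] using h
  have hX0 := hL.initial
  obtain ⟨hSm, hmart⟩ := hmart
  have hint : ∀ t, Integrable (fun ω => Real.exp (X t ω)) P := by
    intro t
    have h := (hmart.integrable t).const_mul S₀⁻¹
    refine h.congr (ae_of_all _ fun ω => ?_)
    simp [expAsset, hS₀.ne']
  have hone : ∀ t, ∫ ω, Real.exp (X t ω) ∂P = 1 := by
    intro t
    -- Comparing times `0` and `t` on the whole space gives `E[S_t] = E[S_0] = S₀`.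
    have h := hmart.setIntegral_eq (zero_le (a := t)) MeasurableSet.univ
    have h0 : ∫ ω, expAsset S₀ X 0 ω ∂P = S₀ := by
      rw [integral_congr_ae (g := fun _ => S₀)]
      · simp
      · filter_upwards [hX0] with ω hω
        simp [expAsset, hω]
    rw [setIntegral_univ, setIntegral_univ, h0] at h
    simp only [expAsset] at h
    rw [integral_const_mul] at h
    exact mul_left_cancel₀ hS₀.ne' (h.symm.trans (mul_one S₀).symm)
  have hXm : ∀ t, AEMeasurable (X t) P := fun t => (hL.measurable t).aemeasurable
  have hcall : ∀ t, callPrice P S₀ X t 0 = ∫ x, max (Real.exp x - 1) 0 ∂(P.map (X t)) := by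
    intro t
    rw [integral_map (hXm t) (Measurable.aestronglyMeasurable (by fun_prop)), callPrice,
      ← integral_const_mul]
    refine integral_congr_ae (ae_of_all _ fun ω => ?_)
    simp only [expAsset, neg_zero, Real.exp_zero]
    rw [show S₀ * Real.exp (X t ω) - S₀ * 1 = S₀ * (Real.exp (X t ω) - 1) by ring,
      show max (S₀ * (Real.exp (X t ω) - 1)) 0 = S₀ * max (Real.exp (X t ω) - 1) 0 by
        rw [mul_max_of_nonneg _ _ hS₀.le, mul_zero],
      one_div, inv_mul_cancel_left₀ hS₀.ne']
  have := isLittleO_integral_max_exp_sub_one (μ := fun t => P.map (X t)) (ψ := ψ) (a := a) (Y := Y)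
    (K := K) (fun t => Measure.isProbabilityMeasure_map (hXm t))
    (fun t u => hL.charFun_map_eq_exp hψ hψ0 htrip.charFun_eq t u)
    (fun t => (integrable_map_measure (Measurable.aestronglyMeasurable (by fun_prop)) (hXm t)).2
      (hint t))
    (fun t => by
      rw [integral_map (hXm t) (Measurable.aestronglyMeasurable (by fun_prop))]; exact hone t)
    hψ ha h1 hKb
    (levyKhintchineExponent_cgmy_re_nonpos hC hG hM0 h1 h2 b)
    (neg_rpow_le_levyKhintchineExponent_cgmy_re hC hG hM0 h1 h2 b)
  simp_rw [hcall, hd1]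
  exact this
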